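/- Let $n\ge 1$ and let $\mathbb R^{2n}=\{(q,p)\}$ carry the standard symplectic form $\sum_{j=1}^n dq_j\wedge dp_j$. Indices are taken modulo $n$. For the $n$-particle periodic Toda chain put $b_j=e^{(q_j-q_{j+1})/2}$, let $L=L(q,p)$ be the $n\times n$ Lax matrix $L_{rs}=p_r\delta_{rs}+b_r\delta_{r+1,s}+b_s\delta_{r,s+1}$ (with $\delta_{rs}=1$ if $r\equiv s \bmod n$ and $0$ otherwise), let $F=(F_1,\dots,F_n):\mathbb R^{2n}\to\mathbb R^n$ with $F_j=\frac1j\operatorname{Tr}L^j$, and for every integer $k\ge 0$ let $$\Sigma_k=\{z\in\mathbb R^{2n} : \operatorname{corank} dF(z)=k\},\qquad \operatorname{corank} dF(z)=n-\operatorname{rank} dF(z).$$ Then, for every $k\ge0$: 1. $\Sigma_k$ is a smooth embedded symplectic submanifold of $\mathbb R^{2n}$ of codimension $2k$. 2. $\Sigma_k$ has exactly $\binom{n-1}{k}$ connected components (so it is empty for $k\ge n$), and these are disconnected from each other: no component meets the closure of another one. 3. $\Sigma_k$ is contained in the closure of $\Sigma_j$ for every $0\le j<k$. -/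

import Mathlib

open scoped ContDiff

noncomputable section

namespace Toda

/-! ### Linear algebra and submanifolds -/

/-- The corank of a linear map: the dimension of its cokernel. For a map into `ℝⁿ` it is `n` minus
the rank, which is the number of independent linear relations among the component functionals. -/
def corank {E F : Type*} [NormedAddCommGroup E] [NormedSpace ℝ E]
    [NormedAddCommGroup F] [NormedSpace ℝ F] (A : E →L[ℝ] F) : ℕ :=
  Module.finrank ℝ (F ⧸ A.toLinearMap.range)

/-- `f` is a smooth local defining map for `S` on the open set `U`, with `c` components: a smooth
submersion `U → ℝᶜ` whose zero set in `U` is `S ∩ U`. If such maps exist around all points of `S`,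
then `S` is an embedded submanifold of codimension `c`, and its tangent space at `x ∈ S ∩ U`
is the kernel of the derivative of `f` at `x`. -/
structure IsLocalDefiningMap {E : Type*} [NormedAddCommGroup E] [NormedSpace ℝ E]
    (S U : Set E) (c : ℕ) (f : E → (Fin c → ℝ)) : Prop where
  isOpen : IsOpen U
  contDiffOn : ContDiffOn ℝ ∞ f U
  surjective : ∀ y ∈ U, Function.Surjective (fderiv ℝ f y)
  inter_eq : S ∩ U = {y | y ∈ U ∧ f y = 0}

/-- The connected components of a subset `S` of a topological space, as subsets of that space. -/
def components {X : Type*} [TopologicalSpace X] (S : Set X) : Set (Set X) :=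
  connectedComponentIn S '' S

/-- The phase space `ℝ²ⁿ` of pairs `(q, p)`. -/
abbrev Phase (n : ℕ) : Type := (Fin n → ℝ) × (Fin n → ℝ)

/-- The standard symplectic form `∑ dq_j ∧ dp_j` on `ℝ²ⁿ`. -/
def omega {n : ℕ} (v w : Phase n) : ℝ :=
  ∑ j, (v.1 j * w.2 j - v.2 j * w.1 j)

/-- `S` is an (embedded, smooth) symplectic submanifold of codimension `c` of `ℝ²ⁿ`: around each of
its points there is a smooth local defining map with `c` components, and the symplectic form is
nondegenerate on the tangent space of `S` at this point. -/
def IsSymplecticSubmanifold {n : ℕ} (S : Set (Phase n)) (c : ℕ) : Prop :=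
  ∀ x ∈ S, ∃ (U : Set (Phase n)) (f : Phase n → (Fin c → ℝ)),
    x ∈ U ∧ IsLocalDefiningMap S U c f ∧
      ∀ v : Phase n, fderiv ℝ f x v = 0 →
        (∀ w : Phase n, fderiv ℝ f x w = 0 → omega v w = 0) → v = 0

/-! ### The periodic Toda chain; indices in `Fin n` are cyclic -/

/-- `b_j = exp ((q_j - q_{j+1}) / 2)`. -/
def b {n : ℕ} [NeZero n] (z : Phase n) (j : Fin n) : ℝ :=
  Real.exp ((z.1 j - z.1 (j + 1)) / 2)

/-- The Lax matrix `L_{rs} = p_r δ_{rs} + b_r δ_{r+1,s} + b_s δ_{r,s+1}`. -/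
def lax {n : ℕ} [NeZero n] (z : Phase n) : Matrix (Fin n) (Fin n) ℝ :=
  Matrix.of fun r s =>
    (if r = s then z.2 r else 0) + (if r + 1 = s then b z r else 0) +
      (if r = s + 1 then b z s else 0)

/-- The integrals of motion `F_j = (1/j) Tr L^j`, `1 ≤ j ≤ n`; the index `i : Fin n` stands for
`j = i + 1`. -/
def integrals {n : ℕ} [NeZero n] (z : Phase n) : Fin n → ℝ :=
  fun i => (1 / ((i : ℕ) + 1 : ℝ)) * (lax z ^ ((i : ℕ) + 1)).trace

/-- `Σ_k`, the set of points of phase space where `dF` has corank `k`. -/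
def singularSet (n : ℕ) [NeZero n] (k : ℕ) : Set (Phase n) :=
  {z | corank (fderiv ℝ (integrals (n := n)) z) = k}

end Toda

end

noncomputable section

set_option linter.unusedSimpArgs false

namespace Toda

/-! ### The monodromy matrix -/

/-! Let M(x) be the ordered product of the 2×2 transfer matrices, with spectral parameter x. Then
det M = 1 and det(x - L) = tr M(x) - 2 (`det_sub_lax`), so by Newton's identities a vector is killed
by dF exactly when it does not change the discriminant tr M(x) to first order. The entry M₀₁(x) is a
polynomial of degree n - 1 with real simple roots μ_j (`card_dirichletSet`), which are smooth
functions on phase space. The j-th gap is closed when M(μ_j) is scalar, which amounts to two real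
equations (`gap`).

The derivative of tr M has degree at most n - 1 in x, so it is fixed by its leading coefficient and
its values at the μ_j. Such a value is forced to vanish when the gap is closed, because det M = 1,
and can be moved freely when it is open. Hence corank dF is the number of closed gaps
(`corank_fderiv_integrals`), and Σ_k is the disjoint union of the sets `stratum S` with |S| = k.

The quadratic r-matrix bracket (`dmono_hvf`) shows that, where gaps are closed, gap functions of
different gaps Poisson commute, while the two functions of one gap have nonzero bracket, by
positivity of a Wronskian. So the gap equations are independent and cut out symplectic submanifolds
(`ker_gap_symplectic`); near any point the strata look like products of points, punctured discs and
a ball.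

For connectedness, consider the closed set where at least the gaps in S are closed. The Toda flow is
tangent to it and its tangent spaces are symplectic, so the proper function `energy` has no local
minimum on it except the equilibrium 0. Two disjoint closed pieces would each contain such a
minimum; thus this set is connected (`isPreconnected_closedStratum`). Since only sets of codimension
two are removed, `stratum S` is connected and dense in it, which gives both the count of components
and the closure relations. -/

/-- The transfer matrix of the site `i` at the spectral parameter `x`. -/
def transfer {n : ℕ} (z : Phase n) (x : ℝ) (i : Fin n) : Matrix (Fin 2) (Fin 2) ℝ :=
  !![x - z.2 i, -Real.exp (-z.1 i); Real.exp (z.1 i), 0]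

/-- The ordered product of the transfer matrices of the first `k` sites. -/
def mono {n : ℕ} [NeZero n] (z : Phase n) (x : ℝ) : ℕ → Matrix (Fin 2) (Fin 2) ℝ
  | 0 => 1
  | k + 1 => transfer z x (Fin.ofNat n k) * mono z x k

/-- The derivative of the transfer matrix in the direction `(v, t)`. -/
def dtransfer {n : ℕ} (z v : Phase n) (t : ℝ) (i : Fin n) : Matrix (Fin 2) (Fin 2) ℝ :=
  !![t - v.2 i, Real.exp (-z.1 i) * v.1 i; Real.exp (z.1 i) * v.1 i, 0]

/-- The derivative of `mono` in the direction `(v, t)`. -/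
def dmono {n : ℕ} [NeZero n] (z : Phase n) (x : ℝ) (v : Phase n) (t : ℝ) :
    ℕ → Matrix (Fin 2) (Fin 2) ℝ
  | 0 => 0
  | k + 1 => dtransfer z v t (Fin.ofNat n k) * mono z x k +
      transfer z x (Fin.ofNat n k) * dmono z x v t k

lemma det_transfer {n : ℕ} (z : Phase n) (x : ℝ) (i : Fin n) : (transfer z x i).det = 1 := by
  simp [transfer, Matrix.det_fin_two, ← Real.exp_add]

lemma det_mono {n : ℕ} [NeZero n] (z : Phase n) (x : ℝ) (k : ℕ) : (mono z x k).det = 1 := by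
  induction k with
  | zero => simp [mono]
  | succ k ih => rw [mono, Matrix.det_mul, ih, det_transfer, one_mul]

lemma contDiff_transfer {n : ℕ} (i : Fin n) (r s : Fin 2) :
    ContDiff ℝ ∞ fun w : Phase n × ℝ => transfer w.1 w.2 i r s := by
  fin_cases r <;> fin_cases s <;> simp [transfer] <;> fun_prop

lemma contDiff_mono {n : ℕ} [NeZero n] (k : ℕ) (r s : Fin 2) :
    ContDiff ℝ ∞ fun w : Phase n × ℝ => mono w.1 w.2 k r s := by
  induction k generalizing r s with
  | zero => simp only [mono]; fun_prop
  | succ k ih =>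
    simp only [mono, Matrix.mul_apply, Fin.sum_univ_two]
    exact ((contDiff_transfer _ _ _).mul (ih _ _)).add ((contDiff_transfer _ _ _).mul (ih _ _))

lemma fderiv_transfer {n : ℕ} (i : Fin n) (r s : Fin 2) (z : Phase n) (x : ℝ)
    (v : Phase n) (t : ℝ) :
    fderiv ℝ (fun w : Phase n × ℝ => transfer w.1 w.2 i r s) (z, x) (v, t) =
      dtransfer z v t i r s := by
  let π : Phase n × ℝ →L[ℝ] Phase n := ContinuousLinearMap.fst ℝ (Phase n) ℝ
  let ρ : (Fin n → ℝ) →L[ℝ] ℝ := ContinuousLinearMap.proj i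
  have hq : HasFDerivAt (fun w : Phase n × ℝ => w.1.1 i)
      (ρ.comp ((ContinuousLinearMap.fst ℝ (Fin n → ℝ) (Fin n → ℝ)).comp π)) (z, x) :=
    (ρ.comp ((ContinuousLinearMap.fst ℝ (Fin n → ℝ) (Fin n → ℝ)).comp π)).hasFDerivAt
  have hp : HasFDerivAt (fun w : Phase n × ℝ => w.1.2 i)
      (ρ.comp ((ContinuousLinearMap.snd ℝ (Fin n → ℝ) (Fin n → ℝ)).comp π)) (z, x) :=
    (ρ.comp ((ContinuousLinearMap.snd ℝ (Fin n → ℝ) (Fin n → ℝ)).comp π)).hasFDerivAt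
  have hx : HasFDerivAt (fun w : Phase n × ℝ => w.2)
      (ContinuousLinearMap.snd ℝ (Phase n) ℝ) (z, x) :=
    (ContinuousLinearMap.snd ℝ (Phase n) ℝ).hasFDerivAt
  fin_cases r <;> fin_cases s <;> simp only [transfer, dtransfer, Fin.zero_eta, Fin.mk_one,
    Matrix.of_apply, Matrix.cons_val_zero, Matrix.cons_val_one, Matrix.cons_val', Fin.isValue]
  · rw [(hx.fun_sub hp).fderiv]; simp [ρ, π]
  · rw [(hq.fun_neg.exp.fun_neg).fderiv]; simp [ρ, π]
  · rw [hq.exp.fderiv]; simp [ρ, π]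
  · simp

lemma fderiv_mono {n : ℕ} [NeZero n] (k : ℕ) (r s : Fin 2) (z : Phase n) (x : ℝ)
    (v : Phase n) (t : ℝ) :
    fderiv ℝ (fun w : Phase n × ℝ => mono w.1 w.2 k r s) (z, x) (v, t) =
      dmono z x v t k r s := by
  induction k generalizing r s with
  | zero => simp [mono, dmono]
  | succ k ih =>
    simp only [mono, dmono, Matrix.mul_apply, Fin.sum_univ_two, Matrix.add_apply]
    have ht := fun r s => ((contDiff_transfer (n := n) (Fin.ofNat n k) r s).differentiable
      (by simp)).differentiableAt (x := (z, x))
    have hm := fun r s => ((contDiff_mono (n := n) k r s).differentiable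
      (by simp)).differentiableAt (x := (z, x))
    rw [(((ht r 0).hasFDerivAt.fun_mul (hm 0 s).hasFDerivAt).fun_add
      ((ht r 1).hasFDerivAt.fun_mul (hm 1 s).hasFDerivAt)).fderiv]
    simp only [add_apply, smul_apply, ih, fderiv_transfer,
      smul_eq_mul]
    ring

lemma dmono_add {n : ℕ} [NeZero n] (z : Phase n) (x : ℝ) (v w : Phase n) (t u : ℝ) (k : ℕ) :
    dmono z x (v + w) (t + u) k = dmono z x v t k + dmono z x w u k := by
  ext r s
  rw [Matrix.add_apply, ← fderiv_mono, ← fderiv_mono, ← fderiv_mono, ← map_add]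
  rfl

lemma dmono_smul {n : ℕ} [NeZero n] (z : Phase n) (x : ℝ) (c : ℝ) (v : Phase n) (t : ℝ) (k : ℕ) :
    dmono z x (c • v) (c * t) k = c • dmono z x v t k := by
  ext r s
  rw [Matrix.smul_apply, ← fderiv_mono, ← fderiv_mono, ← map_smul]
  rfl

/-- The trace of `M⁻¹ dM` vanishes, written at points where `M` is diagonal. -/
lemma dmono_det {n : ℕ} [NeZero n] (z : Phase n) (x : ℝ) (v : Phase n) (t : ℝ) (k : ℕ) :
    dmono z x v t k 0 0 * mono z x k 1 1 + mono z x k 0 0 * dmono z x v t k 1 1 -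
      (dmono z x v t k 0 1 * mono z x k 1 0 + mono z x k 0 1 * dmono z x v t k 1 0) = 0 := by
  induction k with
  | zero => simp [dmono]
  | succ k ih =>
    have h := det_mono z x k
    rw [Matrix.det_fin_two] at h
    have he : Real.exp (-z.1 (Fin.ofNat n k)) * Real.exp (z.1 (Fin.ofNat n k)) = 1 := by
      rw [← Real.exp_add]; simp
    simp only [mono, dmono, Matrix.mul_apply, Fin.sum_univ_two, Matrix.add_apply, transfer,
      dtransfer, Matrix.of_apply, Matrix.cons_val_zero, Matrix.cons_val_one, Matrix.cons_val',
      Fin.isValue, Matrix.cons_val_fin_one]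
    generalize Real.exp (-z.1 (Fin.ofNat n k)) = e at *
    generalize Real.exp (z.1 (Fin.ofNat n k)) = f at *
    linear_combination (e * f) * ih

end Toda

namespace Toda

/-! ### Poisson brackets of the entries of the monodromy matrix -/

lemma dmono_congr {n : ℕ} [NeZero n] (z : Phase n) (x : ℝ) {v w : Phase n} (t : ℝ) {k : ℕ}
    (h : ∀ j < k, v.1 (Fin.ofNat n j) = w.1 (Fin.ofNat n j) ∧
      v.2 (Fin.ofNat n j) = w.2 (Fin.ofNat n j)) :
    dmono z x v t k = dmono z x w t k := by
  induction k with
  | zero => rfl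
  | succ k ih =>
    rw [dmono, dmono, ih fun j hj => h j (by omega)]
    simp only [dtransfer, (h k (by omega)).1, (h k (by omega)).2]

lemma dmono_zero {n : ℕ} [NeZero n] (z : Phase n) (x : ℝ) (k : ℕ) : dmono z x 0 0 k = 0 := by
  simpa using dmono_smul z x 0 0 0 k

lemma dmono_smul' {n : ℕ} [NeZero n] (z : Phase n) (x : ℝ) (c : ℝ) (v : Phase n) (k : ℕ) :
    dmono z x (c • v) 0 k = c • dmono z x v 0 k := by
  simpa using dmono_smul z x c v 0 k

lemma dmono_add' {n : ℕ} [NeZero n] (z : Phase n) (x : ℝ) (v w : Phase n) (k : ℕ) :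
    dmono z x (v + w) 0 k = dmono z x v 0 k + dmono z x w 0 k := by
  simpa using dmono_add z x v w 0 0 k

/-- The coordinate vector of `q_i`. -/
def qdir {n : ℕ} (i : Fin n) : Phase n := (Pi.single i 1, 0)

/-- The coordinate vector of `p_i`. -/
def pdir {n : ℕ} (i : Fin n) : Phase n := (0, Pi.single i 1)

/-- The Hamiltonian vector field of an entry of `mono`. -/
def hvf {n : ℕ} [NeZero n] (z : Phase n) (x : ℝ) (k : ℕ) (r s : Fin 2) : Phase n :=
  (fun i => dmono z x (pdir i) 0 k r s, fun i => -dmono z x (qdir i) 0 k r s)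

lemma phase_eq_sum {n : ℕ} (v : Phase n) :
    v = ∑ i, (v.1 i • qdir i + v.2 i • pdir i) := by
  apply Prod.ext <;> ext j <;>
    simp [qdir, pdir, Prod.fst_sum, Prod.snd_sum, Finset.sum_apply, Pi.single_apply]

lemma omega_hvf {n : ℕ} [NeZero n] (z : Phase n) (x : ℝ) (k : ℕ) (r s : Fin 2) (v : Phase n) :
    omega (hvf z x k r s) v = dmono z x v 0 k r s := by
  have h : ∀ w, dmono z x w 0 k r s =
      fderiv ℝ (fun w : Phase n × ℝ => mono w.1 w.2 k r s) (z, x) (w, 0) :=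
    fun w => (fderiv_mono k r s z x w 0).symm
  have h2 : ∀ w, dmono z x w 0 k r s =
      ((fderiv ℝ (fun w : Phase n × ℝ => mono w.1 w.2 k r s) (z, x)).comp
        (ContinuousLinearMap.inl ℝ (Phase n) ℝ)) w := h
  conv_rhs => rw [h2, phase_eq_sum v, map_sum]
  simp only [omega, hvf]
  refine Finset.sum_congr rfl fun i _ => ?_
  rw [map_add, map_smul, map_smul, ← h2, ← h2, smul_eq_mul, smul_eq_mul]
  ring

lemma dtransfer_of_ne {n : ℕ} (z : Phase n) {i j : Fin n} (h : i ≠ j) :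
    dtransfer z (qdir i) 0 j = 0 ∧ dtransfer z (pdir i) 0 j = 0 := by
  constructor <;> ext r s <;> fin_cases r <;> fin_cases s <;>
    simp [dtransfer, qdir, pdir, h.symm]

lemma ofNat_ne {n : ℕ} [NeZero n] {j k : ℕ} (hj : j < n) (hk : k < n) (h : j ≠ k) :
    Fin.ofNat n j ≠ Fin.ofNat n k := by
  intro he
  have := congrArg Fin.val he
  simp [Fin.ofNat, Nat.mod_eq_of_lt hj, Nat.mod_eq_of_lt hk] at this
  exact h this

lemma dmono_site {n : ℕ} [NeZero n] (z : Phase n) (x : ℝ) {k : ℕ} (hk : k < n) :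
    dmono z x (qdir (Fin.ofNat n k)) 0 k = 0 ∧ dmono z x (pdir (Fin.ofNat n k)) 0 k = 0 := by
  constructor <;> rw [← dmono_zero z x k] <;> apply dmono_congr <;> intro j hj <;>
    
    have := ofNat_ne (hj.trans hk) hk hj.ne <;>
    simp only [qdir, pdir, Pi.single_eq_of_ne this, Prod.fst_zero, Prod.snd_zero, Pi.zero_apply,
      and_self]

/-- The quadratic (`r`-matrix) Poisson bracket of the entries of the monodromy matrix. -/
lemma dmono_hvf {n : ℕ} [NeZero n] (z : Phase n) (x y : ℝ) {k : ℕ} (hk : k ≤ n)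
    (a b c d : Fin 2) :
    (x - y) * dmono z y (hvf z x k a b) 0 k c d =
      mono z x k c b * mono z y k a d - mono z x k a d * mono z y k c b := by
  induction k generalizing a b c d with
  | zero => simp [dmono, mono]; fin_cases a <;> fin_cases b <;> fin_cases c <;> fin_cases d <;> simp
  | succ k ih =>
    have hkn : k < n := hk
    set i := Fin.ofNat n k with hi
    -- Only the coordinates of the first k sites enter here, and in those directions the new
    -- transfer matrix is constant.
    have h1 : dmono z y (hvf z x (k + 1) a b) 0 k =
        transfer z x i a 0 • dmono z y (hvf z x k 0 b) 0 k +
          transfer z x i a 1 • dmono z y (hvf z x k 1 b) 0 k := by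
      rw [← dmono_smul', ← dmono_smul', ← dmono_add']
      apply dmono_congr
      intro j hj
      have hne := ofNat_ne (hj.trans hkn) hkn hj.ne
      have hd := dtransfer_of_ne z hne
      rw [← hi] at hd
      simp only [hvf, dmono, ← hi, hd.1, hd.2, Matrix.add_apply, Matrix.mul_apply,
        Fin.sum_univ_two, Prod.fst_add, Prod.snd_add, Prod.smul_fst, Prod.smul_snd, Pi.add_apply,
        Pi.smul_apply, smul_eq_mul, Matrix.zero_apply]
      constructor <;> ring
    have hs := dmono_site z x hkn
    rw [← hi] at hs
    have h2 : (hvf z x (k + 1) a b).1 i = (dtransfer z (pdir i) 0 i * mono z x k) a b := by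
      simp only [hvf, dmono, ← hi, hs.2, Matrix.mul_zero, add_zero]
    have h3 : (hvf z x (k + 1) a b).2 i = -(dtransfer z (qdir i) 0 i * mono z x k) a b := by
      simp only [hvf, dmono, ← hi, hs.1, Matrix.mul_zero, add_zero]
    have i1 := ih hkn.le 0 b 0 d
    have i2 := ih hkn.le 1 b 0 d
    have i3 := ih hkn.le 0 b 1 d
    have i4 := ih hkn.le 1 b 1 d
    simp only [dmono, mono, ← hi, h1, Matrix.add_apply, Matrix.mul_apply, Fin.sum_univ_two,
      Matrix.smul_apply, smul_eq_mul]
    simp only [Matrix.mul_apply, Fin.sum_univ_two] at h2 h3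
    have q1 : (qdir i).1 i = 1 := by simp [qdir]
    have q2 : (qdir i).2 i = 0 := by simp [qdir]
    have p1 : (pdir i).1 i = 0 := by simp [pdir]
    have p2 : (pdir i).2 i = 1 := by simp [pdir]
    simp only [transfer, dtransfer, q1, q2, p1, p2] at h2 h3 ⊢
    generalize Real.exp (-z.1 i) = e at *
    generalize Real.exp (z.1 i) = f at *
    fin_cases a <;> fin_cases c <;>
    simp at h2 h3 <;>
    simp [h2, h3]
    -- The inductive instances are weighted by the entries of T(x) ⊗ T(y), where T is the new
    -- transfer matrix; the bracket among entries of T itself is already substituted through `h2`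
    -- and `h3`.
    · linear_combination (x - z.2 i) * (y - z.2 i) * i1 + (x - z.2 i) * (-e) * i3 +
        (y - z.2 i) * (-e) * i2 + e * e * i4
    · linear_combination f * (x - z.2 i) * i1 + f * (-e) * i2
    · linear_combination f * (y - z.2 i) * i1 + f * (-e) * i3
    · linear_combination f * f * i1

lemma hasDerivAt_mono {n : ℕ} [NeZero n] (z : Phase n) (x : ℝ) (k : ℕ) (r s : Fin 2) :
    HasDerivAt (fun y => mono z y k r s) (dmono z x 0 1 k r s) x := by
  have h := ((contDiff_mono (n := n) k r s).differentiable (by simp)).differentiableAt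
    (x := (z, x)) |>.hasFDerivAt
  have h2 : HasDerivAt (fun y : ℝ => (z, y)) ((0 : Phase n), (1 : ℝ)) x :=
    (hasDerivAt_const x z).prodMk (hasDerivAt_id x)
  rw [← fderiv_mono]
  exact h.comp_hasDerivAt x h2

lemma continuous_dmono {n : ℕ} [NeZero n] (z v : Phase n) (t : ℝ) (k : ℕ) (r s : Fin 2) :
    Continuous fun x => dmono z x v t k r s := by
  simp only [← fderiv_mono]
  have h := (contDiff_mono (n := n) k r s).continuous_fderiv (by simp)
  exact (h.comp (by fun_prop : Continuous fun x : ℝ => (z, x))).clm_apply continuous_const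

/-- This is the limit y → x of `dmono_hvf`: if g is continuous, (x - y) g(y) has derivative -g(x) at
y = x. -/
lemma dmono_hvf_self {n : ℕ} [NeZero n] (z : Phase n) (x : ℝ) (a b c d : Fin 2) :
    dmono z x (hvf z x n a b) 0 n c d =
      mono z x n a d * dmono z x 0 1 n c b - mono z x n c b * dmono z x 0 1 n a d := by
  have h1 : HasDerivAt (fun y => (x - y) * dmono z y (hvf z x n a b) 0 n c d)
      (-dmono z x (hvf z x n a b) 0 n c d) x := by
    rw [hasDerivAt_iff_tendsto_slope]
    have hc := (continuous_dmono z (hvf z x n a b) 0 n c d).neg.tendsto x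
    refine (hc.mono_left nhdsWithin_le_nhds).congr' ?_
    filter_upwards [self_mem_nhdsWithin] with y hy
    have : y - x ≠ 0 := sub_ne_zero.2 hy
    simp only [slope, sub_self, zero_mul, vsub_eq_sub, sub_zero, smul_eq_mul, Pi.neg_apply]
    field_simp
    ring
  have h2 : HasDerivAt (fun y => mono z x n c b * mono z y n a d - mono z x n a d * mono z y n c b)
      (mono z x n c b * dmono z x 0 1 n a d - mono z x n a d * dmono z x 0 1 n c b) x :=
    ((hasDerivAt_mono z x n a d).const_mul _).fun_sub ((hasDerivAt_mono z x n c b).const_mul _)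
  simp only [dmono_hvf z x _ le_rfl] at h1
  have := h1.unique h2
  linarith

/-! ### Lax-type flows -/

/-- Discrete zero curvature: the terms at consecutive sites telescope. Around the full period A
returns to A 0, so the monodromy matrix moves by a commutator. -/
lemma dmono_lax {n : ℕ} [NeZero n] (z : Phase n) (x : ℝ) (v : Phase n) (t : ℝ)
    (A : Fin n → Matrix (Fin 2) (Fin 2) ℝ)
    (h : ∀ i, dtransfer z v t i = A (i + 1) * transfer z x i - transfer z x i * A i) (k : ℕ) :
    dmono z x v t k = A (Fin.ofNat n k) * mono z x k - mono z x k * A 0 := by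
  induction k with
  | zero => simp [dmono, mono]
  | succ k ih =>
    have hk : Fin.ofNat n (k + 1) = Fin.ofNat n k + 1 := by
      apply Fin.ext
      simp [Fin.ofNat, Fin.val_add]
    rw [dmono, mono, ih, h, hk]
    noncomm_ring

/-- The translation of all positions. -/
def qshift (n : ℕ) : Phase n := (fun _ => 1, 0)

/-- The translation of all momenta. -/
def pshift (n : ℕ) : Phase n := (0, fun _ => 1)

lemma dmono_qshift {n : ℕ} [NeZero n] (z : Phase n) (x : ℝ) (k : ℕ) :
    dmono z x (qshift n) 0 k =
      !![(-1 / 2 : ℝ), 0; 0, 1 / 2] * mono z x k - mono z x k * !![(-1 / 2 : ℝ), 0; 0, 1 / 2] := by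
  refine dmono_lax z x _ 0 (fun _ => !![(-1 / 2 : ℝ), 0; 0, 1 / 2]) (fun i => ?_) k
  ext r s
  fin_cases r <;> fin_cases s <;> simp [dtransfer, transfer, qshift] <;> ring

/-- The vector field of the periodic Toda flow. -/
def todaField {n : ℕ} [NeZero n] (z : Phase n) : Phase n :=
  (z.2, fun i => Real.exp (z.1 (i - 1) - z.1 i) - Real.exp (z.1 i - z.1 (i + 1)))

lemma dmono_todaField {n : ℕ} [NeZero n] (z : Phase n) (x : ℝ) :
    ∃ A, dmono z x (todaField z) 0 n = A * mono z x n - mono z x n * A := by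
  set A : Fin n → Matrix (Fin 2) (Fin 2) ℝ := fun i =>
    -!![0, -Real.exp (-z.1 i); Real.exp (z.1 (i - 1)), -x] with hA
  refine ⟨A 0, ?_⟩
  have h0 : Fin.ofNat n n = 0 := by simp
  conv_rhs => enter [1, 1, 1]; rw [← h0]
  refine dmono_lax z x _ 0 A (fun i => ?_) n
  ext r s
  fin_cases r <;> fin_cases s <;>
    simp [hA, dtransfer, transfer, todaField, Real.exp_sub, Real.exp_neg] <;> field_simp <;> ring

end Toda

namespace Toda
open Polynomial

/-! ### Positivity -/

/-- The Wronskian of a solution with its derivative in the spectral parameter. -/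
lemma wronskian_eq_sum {n : ℕ} [NeZero n] (z : Phase n) (x α β : ℝ) (k : ℕ) :
    (dmono z x 0 1 k 0 0 * α + dmono z x 0 1 k 0 1 * β) *
        (mono z x k 1 0 * α + mono z x k 1 1 * β) -
      (mono z x k 0 0 * α + mono z x k 0 1 * β) *
        (dmono z x 0 1 k 1 0 * α + dmono z x 0 1 k 1 1 * β) =
      ∑ j ∈ Finset.range k, Real.exp (z.1 (Fin.ofNat n j)) *
        (mono z x j 0 0 * α + mono z x j 0 1 * β) ^ 2 := by
  induction k with
  | zero => simp [dmono]
  | succ k ih =>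
    have he : Real.exp (-z.1 (Fin.ofNat n k)) * Real.exp (z.1 (Fin.ofNat n k)) = 1 := by
      rw [← Real.exp_add]; simp
    rw [Finset.sum_range_succ, ← ih]
    simp only [mono, dmono, Matrix.mul_apply, Fin.sum_univ_two, Matrix.add_apply, transfer,
      dtransfer, Matrix.of_apply, Matrix.cons_val_zero, Matrix.cons_val_one, Matrix.cons_val',
      Fin.isValue, Matrix.cons_val_fin_one]
    generalize Real.exp (-z.1 (Fin.ofNat n k)) = e at *
    generalize Real.exp (z.1 (Fin.ofNat n k)) = f at *
    simp only [Prod.fst_zero, Prod.snd_zero, Pi.zero_apply]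
    linear_combination ((dmono z x 0 1 k 0 0 * α + dmono z x 0 1 k 0 1 * β) *
        (mono z x k 1 0 * α + mono z x k 1 1 * β) -
      (mono z x k 0 0 * α + mono z x k 0 1 * β) *
        (dmono z x 0 1 k 1 0 * α + dmono z x 0 1 k 1 1 * β)) * he

/-- The summand j = 0 is positive if α ≠ 0; otherwise the summand j = 1 is, which is why two sites
are needed. -/
lemma wronskian_pos {n : ℕ} [NeZero n] (z : Phase n) (x : ℝ) {α β : ℝ} {k : ℕ} (hk : 2 ≤ k)
    (h : α ≠ 0 ∨ β ≠ 0) :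
    0 < (dmono z x 0 1 k 0 0 * α + dmono z x 0 1 k 0 1 * β) *
        (mono z x k 1 0 * α + mono z x k 1 1 * β) -
      (mono z x k 0 0 * α + mono z x k 0 1 * β) *
        (dmono z x 0 1 k 1 0 * α + dmono z x 0 1 k 1 1 * β) := by
  rw [wronskian_eq_sum]
  by_cases hα : α = 0
  · have hβ : β ≠ 0 := by tauto
    refine Finset.sum_pos' (fun _ _ => by positivity) ⟨1, Finset.mem_range.2 hk, ?_⟩
    simp only [mono, mul_one, transfer, hα]
    simp
    positivity
  · refine Finset.sum_pos' (fun _ _ => by positivity) ⟨0, by simp; omega, ?_⟩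
    simp only [mono]
    simp
    positivity

/-! ### The Dirichlet spectrum -/

/-- The second column of `mono`, as polynomials in the spectral parameter. -/
def colPoly {n : ℕ} [NeZero n] (z : Phase n) : ℕ → ℝ[X] × ℝ[X]
  | 0 => (0, 1)
  | k + 1 => ((X - C (z.2 (Fin.ofNat n k))) * (colPoly z k).1 -
      C (Real.exp (-z.1 (Fin.ofNat n k))) * (colPoly z k).2,
      C (Real.exp (z.1 (Fin.ofNat n k))) * (colPoly z k).1)

lemma eval_colPoly {n : ℕ} [NeZero n] (z : Phase n) (x : ℝ) (k : ℕ) :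
    (colPoly z k).1.eval x = mono z x k 0 1 ∧ (colPoly z k).2.eval x = mono z x k 1 1 := by
  induction k with
  | zero => simp [colPoly, mono]
  | succ k ih =>
    constructor <;>
    simp [colPoly, mono, transfer, Matrix.mul_apply, Fin.sum_univ_two, ih.1, ih.2, sub_eq_add_neg]

/-- The column starts at (0, 1), so the first site only produces a nonzero constant; every later
site raises the degree of the upper entry by one. -/
lemma colPoly_degree {n : ℕ} [NeZero n] (z : Phase n) (k : ℕ) :
    (colPoly z (k + 1)).1.natDegree ≤ k ∧ (colPoly z (k + 1)).1.coeff k ≠ 0 ∧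
      (colPoly z (k + 1)).2.natDegree ≤ k := by
  induction k with
  | zero =>
    have h : colPoly z 1 = (C (-Real.exp (-z.1 (Fin.ofNat n 0))), 0) := by simp [colPoly]
    rw [h]
    simp only [natDegree_C, coeff_C_zero, natDegree_zero]
    exact ⟨le_rfl, neg_ne_zero.2 (Real.exp_pos _).ne', le_rfl⟩
  | succ k ih =>
    obtain ⟨h1, h2, h3⟩ := ih
    refine ⟨?_, ?_, ?_⟩
    · rw [colPoly]
      refine (natDegree_sub_le _ _).trans (max_le ?_ ?_)
      · refine natDegree_mul_le.trans ?_
        rw [natDegree_X_sub_C]; omega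
      · exact (natDegree_C_mul_le _ _).trans (by omega)
    · rw [colPoly]
      have h4 : (colPoly z (k + 1)).1.coeff (k + 1) = 0 :=
        coeff_eq_zero_of_natDegree_lt (by omega)
      have h5 : (colPoly z (k + 1)).2.coeff (k + 1) = 0 :=
        coeff_eq_zero_of_natDegree_lt (by omega)
      simpa [sub_mul, coeff_X_mul, h4, h5] using h2
    · rw [colPoly]
      exact (natDegree_C_mul_le _ _).trans (by omega)

lemma natDegree_colPoly {n : ℕ} [NeZero n] (z : Phase n) :
    (colPoly z n).1.natDegree = n - 1 := by
  obtain ⟨k, hk⟩ : ∃ k, n = k + 1 := ⟨n - 1, (Nat.succ_pred_eq_of_ne_zero (NeZero.ne n)).symm⟩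
  have h := colPoly_degree z k
  rw [show colPoly z n = colPoly z (k + 1) from congrArg _ hk]
  rw [show n - 1 = k by omega]
  exact le_antisymm h.1 (le_natDegree_of_ne_zero h.2.1)

/-- The complex counterpart of the Wronskian identity. At a zero of the upper entry the left side
vanishes while the sum is positive, which forces the zero to be real. -/
lemma im_colPoly {n : ℕ} [NeZero n] (z : Phase n) (x : ℂ) (k : ℕ) :
    (aeval x (colPoly z k).1 * (starRingEnd ℂ) (aeval x (colPoly z k).2)).im =
      x.im * ∑ j ∈ Finset.range k, Real.exp (z.1 (Fin.ofNat n j)) *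
        Complex.normSq (aeval x (colPoly z j).1) := by
  induction k with
  | zero => simp [colPoly]
  | succ k ih =>
    have he : Real.exp (-z.1 (Fin.ofNat n k)) * Real.exp (z.1 (Fin.ofNat n k)) = 1 := by
      rw [← Real.exp_add]; simp
    rw [Finset.sum_range_succ, mul_add, ← ih]
    simp only [colPoly, map_mul, map_sub, aeval_X, aeval_C, Complex.coe_algebraMap,
      Complex.conj_ofReal]
    generalize Real.exp (-z.1 (Fin.ofNat n k)) = e at *
    generalize Real.exp (z.1 (Fin.ofNat n k)) = f at *
    generalize aeval x (colPoly z k).1 = A at *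
    generalize aeval x (colPoly z k).2 = B at *
    simp [Complex.normSq_apply]
    linear_combination (A.im * B.re - A.re * B.im) * he

lemma im_eq_zero_of_isRoot {n : ℕ} [NeZero n] (z : Phase n) (x : ℂ) (hn : 2 ≤ n)
    (h : aeval x (colPoly z n).1 = 0) : x.im = 0 := by
  have h1 := im_colPoly z x n
  rw [h, zero_mul, Complex.zero_im, eq_comm, mul_eq_zero] at h1
  refine h1.resolve_right (ne_of_gt ?_)
  refine Finset.sum_pos' (fun _ _ => mul_nonneg (Real.exp_pos _).le (Complex.normSq_nonneg _))
    ⟨1, Finset.mem_range.2 hn, mul_pos (Real.exp_pos _) (Complex.normSq_pos.2 ?_)⟩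
  simp [colPoly]

lemma eval_derivative_colPoly {n : ℕ} [NeZero n] (z : Phase n) (x : ℝ) (k : ℕ) :
    (colPoly z k).1.derivative.eval x = dmono z x 0 1 k 0 1 := by
  refine ((colPoly z k).1.hasDerivAt x).unique ?_
  simpa only [(eval_colPoly z _ k).1] using hasDerivAt_mono z x k 0 1

/-- At a zero of the upper entry, the Wronskian of the second column reduces to this product; in
particular the zero is simple. -/
lemma dmono_ne_zero_of_root {n : ℕ} [NeZero n] (z : Phase n) {x : ℝ} {k : ℕ} (hk : 2 ≤ k)
    (h : mono z x k 0 1 = 0) : 0 < dmono z x 0 1 k 0 1 * mono z x k 1 1 := by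
  have := wronskian_pos z x hk (α := 0) (β := 1) (by simp)
  simpa [h] using this

/-- The finite set of zeros of the upper right entry of the monodromy matrix. -/
def dirichletSet {n : ℕ} [NeZero n] (z : Phase n) : Finset ℝ := (colPoly z n).1.roots.toFinset

lemma colPoly_ne_zero {n : ℕ} [NeZero n] (z : Phase n) : (colPoly z n).1 ≠ 0 := by
  intro h
  obtain ⟨k, hk⟩ : ∃ k, n = k + 1 := ⟨n - 1, (Nat.succ_pred_eq_of_ne_zero (NeZero.ne n)).symm⟩
  have h2 := (colPoly_degree z k).2.1
  rw [show colPoly z (k + 1) = colPoly z n from congrArg _ hk.symm, h] at h2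
  simp at h2

lemma mem_dirichletSet {n : ℕ} [NeZero n] (z : Phase n) (x : ℝ) :
    x ∈ dirichletSet z ↔ mono z x n 0 1 = 0 := by
  rw [dirichletSet, Multiset.mem_toFinset, mem_roots (colPoly_ne_zero z), IsRoot,
    (eval_colPoly z x n).1]

/-- All n - 1 complex roots are real by `im_eq_zero_of_isRoot` and simple by
`dmono_ne_zero_of_root`. -/
lemma card_dirichletSet {n : ℕ} [NeZero n] (z : Phase n) : (dirichletSet z).card = n - 1 := by
  have hle : (dirichletSet z).card ≤ n - 1 :=
    (Multiset.toFinset_card_le _).trans ((card_roots' _).trans (natDegree_colPoly z).le)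
  rcases Nat.lt_or_ge n 2 with hn | hn
  · omega
  refine le_antisymm hle ?_
  set P := (colPoly z n).1 with hP
  set Q := P.map (algebraMap ℝ ℂ) with hQ
  have hQ0 : Q ≠ 0 := (Polynomial.map_ne_zero_iff (algebraMap ℝ ℂ).injective).2 (colPoly_ne_zero z)
  have hroot : ∀ w : ℂ, Q.IsRoot w → w = (w.re : ℂ) ∧ P.eval w.re = 0 := by
    intro w hw
    have h1 : aeval w P = 0 := by
      rw [IsRoot, hQ, eval_map_algebraMap] at hw
      exact hw
    have h2 : w = (w.re : ℂ) := by
      apply Complex.ext <;> simp [im_eq_zero_of_isRoot z w hn h1]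
    refine ⟨h2, ?_⟩
    rw [h2] at h1
    have h3 := Polynomial.aeval_algebraMap_apply ℂ w.re P
    rw [Complex.coe_algebraMap, h1] at h3
    simpa using h3.symm
  have hnd : Q.roots.Nodup := by
    rw [Multiset.nodup_iff_count_le_one]
    intro w
    rw [count_roots]
    by_contra hlt
    rw [not_le, one_lt_rootMultiplicity_iff_isRoot hQ0] at hlt
    obtain ⟨h1, h2⟩ := hroot w hlt.1
    have h3 : P.derivative.eval w.re = 0 := by
      have h4 := hlt.2
      rw [IsRoot, hQ, derivative_map, eval_map_algebraMap, h1] at h4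
      have h5 := Polynomial.aeval_algebraMap_apply ℂ w.re (derivative P)
      rw [Complex.coe_algebraMap, h4] at h5
      simpa using h5.symm
    rw [hP, eval_derivative_colPoly] at h3
    rw [hP, (eval_colPoly z _ n).1] at h2
    have := dmono_ne_zero_of_root z hn h2
    rw [h3] at this
    simp at this
  have hcard : Q.roots.toFinset.card = n - 1 := by
    rw [Multiset.toFinset_card_of_nodup hnd, IsAlgClosed.card_roots_eq_natDegree, hQ,
      natDegree_map, natDegree_colPoly]
  rw [← hcard]
  refine Finset.card_le_card_of_injOn Complex.re (fun w hw => ?_) (fun w hw w' hw' h => ?_)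
  · have hw' : Q.IsRoot w := by simpa [hQ0] using hw
    simp only [Finset.mem_coe, dirichletSet, Multiset.mem_toFinset]
    rw [mem_roots (colPoly_ne_zero z)]
    exact (hroot w hw').2
  · have h1 : Q.IsRoot w := by simpa [hQ0] using hw
    have h2 : Q.IsRoot w' := by simpa [hQ0] using hw'
    rw [(hroot w h1).1, (hroot w' h2).1, h]

/-- The zeros of the upper right entry of the monodromy matrix, in increasing order. -/
def dirichlet {n : ℕ} [NeZero n] (j : Fin (n - 1)) (z : Phase n) : ℝ :=
  (dirichletSet z).orderEmbOfFin (card_dirichletSet z) j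

lemma mono_dirichlet {n : ℕ} [NeZero n] (j : Fin (n - 1)) (z : Phase n) :
    mono z (dirichlet j z) n 0 1 = 0 :=
  (mem_dirichletSet z _).1 (Finset.orderEmbOfFin_mem _ _ _)

lemma dirichlet_strictMono {n : ℕ} [NeZero n] (z : Phase n) :
    StrictMono fun j : Fin (n - 1) => dirichlet j z :=
  ((dirichletSet z).orderEmbOfFin (card_dirichletSet z)).strictMono

lemma two_le_of_fin {n : ℕ} (j : Fin (n - 1)) : 2 ≤ n := by
  have := j.2
  omega

lemma dmono_dirichlet_ne {n : ℕ} [NeZero n] (j : Fin (n - 1)) (z : Phase n) :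
    dmono z (dirichlet j z) 0 1 n 0 1 ≠ 0 := fun h => by
  have := dmono_ne_zero_of_root z (two_le_of_fin j) (mono_dirichlet j z)
  simp [h] at this

/-- Each simple root continues smoothly by the implicit function theorem. The continued roots stay
in increasing order nearby and there are n - 1 of them, so they are the ordered enumeration. -/
lemma contDiff_dirichlet {n : ℕ} [NeZero n] (j : Fin (n - 1)) :
    ContDiff ℝ ∞ (dirichlet (n := n) j) := by
  rw [contDiff_iff_contDiffAt]
  intro z
  have hloc : ∀ j : Fin (n - 1), ∃ ν : Phase n → ℝ, ContDiffAt ℝ ∞ ν z ∧ ν z = dirichlet j z ∧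
      ∀ᶠ y in nhds z, mono y (ν y) n 0 1 = 0 := by
    intro j
    have cdf : ContDiffAt ℝ ∞ (fun w : Phase n × ℝ => mono w.1 w.2 n 0 1) (z, dirichlet j z) :=
      (contDiff_mono n 0 1).contDiffAt
    have hinv : (fderiv ℝ (fun w : Phase n × ℝ => mono w.1 w.2 n 0 1) (z, dirichlet j z) ∘L
        .inr ℝ (Phase n) ℝ).IsInvertible := by
      refine ⟨ContinuousLinearEquiv.unitsEquivAut ℝ (Units.mk0 _ (dmono_dirichlet_ne j z)), ?_⟩
      ext
      simp [fderiv_mono]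
    refine ⟨cdf.implicitFunction (by simp) hinv, cdf.contDiffAt_implicitFunction _ _,
      cdf.implicitFunction_apply_self _ _, ?_⟩
    filter_upwards [cdf.eventually_apply_implicitFunction (by simp) hinv] with y hy
    rw [hy]
    exact mono_dirichlet j z
  choose ν h1 h2 h3 using hloc
  have hlt : ∀ i k : Fin (n - 1), i < k → ∀ᶠ y in nhds z, ν i y < ν k y := fun i k hik =>
    (h1 i).continuousAt.eventually_lt (h1 k).continuousAt
      (by rw [h2, h2]; exact dirichlet_strictMono z hik)
  have hmono : ∀ᶠ y in nhds z, StrictMono fun i => ν i y := by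
    simp only [StrictMono, Filter.eventually_all]
    exact hlt
  refine (h1 j).congr_of_eventuallyEq ?_
  filter_upwards [hmono, Filter.eventually_all.2 h3] with y hy1 hy2
  exact (congrFun (Finset.orderEmbOfFin_unique (card_dirichletSet y)
    (fun i => (mem_dirichletSet y _).2 (hy2 i)) hy1) j).symm

end Toda

namespace Toda

/-! ### The gap functions -/

/-- The two functions whose simultaneous vanishing means that the `j`-th gap is closed: the
monodromy matrix at the `j`-th Dirichlet eigenvalue is then scalar. -/
def gap {n : ℕ} [NeZero n] (j : Fin (n - 1)) (z : Phase n) : Fin 2 → ℝ :=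
  ![mono z (dirichlet j z) n 0 0 - mono z (dirichlet j z) n 1 1, mono z (dirichlet j z) n 1 0]

lemma contDiff_mono_dirichlet {n : ℕ} [NeZero n] (j : Fin (n - 1)) (r s : Fin 2) :
    ContDiff ℝ ∞ fun z : Phase n => mono z (dirichlet j z) n r s :=
  (contDiff_mono n r s).comp (contDiff_id.prodMk (contDiff_dirichlet j))

lemma contDiff_gap {n : ℕ} [NeZero n] (j : Fin (n - 1)) : ContDiff ℝ ∞ (gap (n := n) j) := by
  rw [contDiff_pi]
  intro e
  fin_cases e
  · exact (contDiff_mono_dirichlet j 0 0).sub (contDiff_mono_dirichlet j 1 1)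
  · exact contDiff_mono_dirichlet j 1 0

lemma fderiv_mono_dirichlet {n : ℕ} [NeZero n] (j : Fin (n - 1)) (r s : Fin 2) (z v : Phase n) :
    fderiv ℝ (fun z : Phase n => mono z (dirichlet j z) n r s) z v =
      dmono z (dirichlet j z) v (fderiv ℝ (dirichlet j) z v) n r s := by
  rw [← fderiv_mono]
  have h1 := ((contDiff_mono (n := n) n r s).differentiable (by simp)).differentiableAt
    (x := (z, dirichlet j z)) |>.hasFDerivAt
  have h2 := ((contDiff_dirichlet (n := n) j).differentiable (by simp)).differentiableAt
    (x := z) |>.hasFDerivAt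
  have h3 : HasFDerivAt (fun y : Phase n => (y, dirichlet j y))
    ((ContinuousLinearMap.id ℝ (Phase n)).prod (fderiv ℝ (dirichlet j) z)) z :=
    (hasFDerivAt_id z).prodMk h2
  have h4 := (HasFDerivAt.comp z h1 h3).fderiv
  have h5 := congrArg (fun L : Phase n →L[ℝ] ℝ => L v) h4
  exact h5

lemma dmono_split {n : ℕ} [NeZero n] (z : Phase n) (x : ℝ) (v : Phase n) (t : ℝ) (k : ℕ) :
    dmono z x v t k = dmono z x v 0 k + t • dmono z x 0 1 k := by
  rw [← dmono_smul, ← dmono_add]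
  simp

lemma fderiv_dirichlet {n : ℕ} [NeZero n] (j : Fin (n - 1)) (z v : Phase n) :
    fderiv ℝ (dirichlet j) z v =
      -(dmono z (dirichlet j z) v 0 n 0 1 / dmono z (dirichlet j z) 0 1 n 0 1) := by
  have h := fderiv_mono_dirichlet j 0 1 z v
  have h2 : (fun z : Phase n => mono z (dirichlet j z) n 0 1) = fun _ => 0 :=
    funext fun z => mono_dirichlet j z
  rw [h2, dmono_split] at h
  have h3 := dmono_dirichlet_ne j z
  simp at h
  field_simp
  linarith

lemma fderiv_gap {n : ℕ} [NeZero n] (j : Fin (n - 1)) (z v : Phase n) :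
    fderiv ℝ (gap j) z v =
      ![dmono z (dirichlet j z) v (fderiv ℝ (dirichlet j) z v) n 0 0 -
        dmono z (dirichlet j z) v (fderiv ℝ (dirichlet j) z v) n 1 1,
        dmono z (dirichlet j z) v (fderiv ℝ (dirichlet j) z v) n 1 0] := by
  have hd := fun r s => ((contDiff_mono_dirichlet (n := n) j r s).differentiable
    (by simp)).differentiableAt (x := z)
  have hg := ((contDiff_gap (n := n) j).differentiable (by simp)).differentiableAt (x := z)
  have hp := hasFDerivAt_pi'.1 hg.hasFDerivAt
  ext e
  fin_cases e
  · have h1 := (hp 0).unique ((hd 0 0).hasFDerivAt.fun_sub (hd 1 1).hasFDerivAt)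
    have h2 := congrArg (fun L : Phase n →L[ℝ] ℝ => L v) h1
    simpa [fderiv_mono_dirichlet] using h2
  · have h1 := (hp 1).unique (hd 1 0).hasFDerivAt
    have h2 := congrArg (fun L : Phase n →L[ℝ] ℝ => L v) h1
    simpa [fderiv_mono_dirichlet] using h2

/-- The Hamiltonian vector fields of the two components of `gap j`. -/
def gapField {n : ℕ} [NeZero n] (j : Fin (n - 1)) (z : Phase n) (e : Fin 2) : Phase n :=
  let x := dirichlet j z
  let N := dmono z x 0 1 n
  ![hvf z x n 0 0 + (-1 : ℝ) • hvf z x n 1 1 + (-((N 0 0 - N 1 1) / N 0 1)) • hvf z x n 0 1,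
    hvf z x n 1 0 + (-(N 1 0 / N 0 1)) • hvf z x n 0 1] e

lemma omega_add {n : ℕ} (u v w : Phase n) : omega (u + v) w = omega u w + omega v w := by
  simp only [omega, ← Finset.sum_add_distrib, Prod.fst_add, Prod.snd_add, Pi.add_apply]
  exact Finset.sum_congr rfl fun i _ => by ring

lemma omega_smul {n : ℕ} (c : ℝ) (v w : Phase n) : omega (c • v) w = c * omega v w := by
  simp only [omega, Finset.mul_sum, Prod.smul_fst, Prod.smul_snd, Pi.smul_apply, smul_eq_mul]
  exact Finset.sum_congr rfl fun i _ => by ring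

lemma omega_neg {n : ℕ} (v w : Phase n) : omega (-v) w = -omega v w := by
  simpa using omega_smul (-1) v w

lemma dmono_neg {n : ℕ} [NeZero n] (z : Phase n) (x : ℝ) (v : Phase n) (k : ℕ) :
    dmono z x (-v) 0 k = -dmono z x v 0 k := by
  simpa using dmono_smul' z x (-1) v k

lemma omega_swap {n : ℕ} (v w : Phase n) : omega v w = -omega w v := by
  simp only [omega, ← Finset.sum_neg_distrib]
  exact Finset.sum_congr rfl fun i _ => by ring

lemma omega_gapField {n : ℕ} [NeZero n] (j : Fin (n - 1)) (z : Phase n) (e : Fin 2)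
    (v : Phase n) : omega (gapField j z e) v = fderiv ℝ (gap j) z v e := by
  have hN := dmono_dirichlet_ne j z
  rw [fderiv_gap, fderiv_dirichlet, dmono_split]
  fin_cases e <;> simp [gapField, omega_add, omega_smul, omega_neg, omega_hvf] <;> field_simp <;> ring

/-- A closed gap: the monodromy matrix is `σ = ±1`. -/
lemma gap_eq_zero {n : ℕ} [NeZero n] {j : Fin (n - 1)} {z : Phase n} (h : gap j z = 0) :
    ∃ σ : ℝ, σ ≠ 0 ∧ ∀ r s, mono z (dirichlet j z) n r s = if r = s then σ else 0 := by
  have h0 := congrFun h 0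
  have h1 := congrFun h 1
  simp only [gap, Matrix.cons_val_zero, Matrix.cons_val_one, Pi.zero_apply,
    Matrix.cons_val_fin_one] at h0 h1
  have hd := det_mono z (dirichlet j z) n
  rw [Matrix.det_fin_two, mono_dirichlet, ← sub_eq_zero.1 h0] at hd
  refine ⟨mono z (dirichlet j z) n 0 0, fun h => by simp [h] at hd, fun r s => ?_⟩
  fin_cases r <;> fin_cases s <;> simp [mono_dirichlet, h1]
  linarith

/-- Both monodromy matrices are scalar, so the two terms of the r-matrix bracket cancel; dividing by
the difference of the Dirichlet eigenvalues is allowed as these are distinct. -/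
lemma fderiv_gap_gapField_of_ne {n : ℕ} [NeZero n] {i j : Fin (n - 1)} {z : Phase n}
    (hi : gap i z = 0) (hj : gap j z = 0) (hij : i ≠ j) (e : Fin 2) :
    fderiv ℝ (gap i) z (gapField j z e) = 0 := by
  obtain ⟨σ, -, hσ⟩ := gap_eq_zero hi
  obtain ⟨τ, -, hτ⟩ := gap_eq_zero hj
  have hne : dirichlet j z - dirichlet i z ≠ 0 :=
    sub_ne_zero.2 fun h => hij ((dirichlet_strictMono z).injective h).symm
  have h0 : ∀ a b c d, dmono z (dirichlet i z) (hvf z (dirichlet j z) n a b) 0 n c d = 0 := by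
    intro a b c d
    have h := dmono_hvf z (dirichlet j z) (dirichlet i z) le_rfl a b c d
    rw [hσ, hσ, hτ, hτ] at h
    have h2 : (dirichlet j z - dirichlet i z) *
        dmono z (dirichlet i z) (hvf z (dirichlet j z) n a b) 0 n c d = 0 := by
      rw [h]
      split_ifs <;> ring
    exact (mul_eq_zero.1 h2).resolve_left hne
  rw [fderiv_gap, fderiv_dirichlet, dmono_split]
  ext k
  fin_cases e <;> fin_cases k <;> simp [gapField, dmono_add', dmono_smul', dmono_neg, h0]

lemma fderiv_gap_gapField_self {n : ℕ} [NeZero n] {j : Fin (n - 1)} {z : Phase n}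
    (hj : gap j z = 0) :
    ∃ κ : ℝ, κ ≠ 0 ∧ fderiv ℝ (gap j) z (gapField j z 0) = ![0, κ] ∧
      fderiv ℝ (gap j) z (gapField j z 1) = ![-κ, 0] := by
  obtain ⟨σ, hσ0, hσ⟩ := gap_eq_zero hj
  have hN := dmono_dirichlet_ne j z
  set N := dmono z (dirichlet j z) 0 1 n with hNdef
  have h0 : ∀ a b c d, dmono z (dirichlet j z) (hvf z (dirichlet j z) n a b) 0 n c d =
      σ * ((if a = d then N c b else 0) - if c = b then N a d else 0) := by
    intro a b c d
    rw [dmono_hvf_self, hσ, hσ, ← hNdef]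
    split_ifs <;> ring
  refine ⟨σ * (4 * N 1 0 + (N 0 0 - N 1 1) ^ 2 / N 0 1), ?_, ?_, ?_⟩
  -- With M = σ, the Wronskian is a quadratic form in (α, β), and κ is a multiple of its
  -- discriminant. This (α, β) completes the square: the form takes the value -κ N₀₁² there, so
  -- positivity gives κ ≠ 0.
  · have hp := wronskian_pos z (dirichlet j z) (two_le_of_fin j) (α := 2 * N 0 1)
      (β := -(N 0 0 - N 1 1)) (Or.inl (by simpa using hN))
    simp only [hσ, ← hNdef] at hp
    refine mul_ne_zero hσ0 fun h => hp.ne ?_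
    field_simp at h
    simp
    linear_combination (σ * N 0 1) * h
  all_goals
    rw [fderiv_gap, fderiv_dirichlet, dmono_split]
    ext k
    fin_cases k <;> simp [gapField, dmono_add', dmono_smul', dmono_neg, h0, ← hNdef] <;> field_simp <;> ring

/-- A commutator with a scalar matrix vanishes, so flows acting on the monodromy by conjugation are
tangent to the closed-gap sets. -/
lemma fderiv_gap_eq_zero_of_commutator {n : ℕ} [NeZero n] {j : Fin (n - 1)} {z : Phase n}
    (hj : gap j z = 0) {v : Phase n} {A : Matrix (Fin 2) (Fin 2) ℝ}
    (h : dmono z (dirichlet j z) v 0 n =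
      A * mono z (dirichlet j z) n - mono z (dirichlet j z) n * A) :
    fderiv ℝ (gap j) z v = 0 := by
  obtain ⟨σ, -, hσ⟩ := gap_eq_zero hj
  have h0 : dmono z (dirichlet j z) v 0 n = 0 := by
    rw [h]
    ext r s
    fin_cases r <;> fin_cases s <;> simp [Matrix.mul_apply, hσ] <;> ring
  rw [fderiv_gap, fderiv_dirichlet, dmono_split, h0]
  ext k
  fin_cases k <;> simp

/-- The matrix of brackets of the closed gap functions is block diagonal with invertible
antisymmetric 2×2 blocks, so it can be inverted gap by gap. -/
lemma exists_fderiv_gap_eq {n : ℕ} [NeZero n] {z : Phase n} {T : Finset (Fin (n - 1))}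
    (hT : ∀ j ∈ T, gap j z = 0) (y : Fin (n - 1) → Fin 2 → ℝ) :
    ∃ c : Fin (n - 1) → Fin 2 → ℝ, ∀ i ∈ T,
      fderiv ℝ (gap i) z (∑ j ∈ T, (c j 0 • gapField j z 0 + c j 1 • gapField j z 1)) = y i := by
  have : ∀ j, ∃ c : Fin 2 → ℝ, j ∈ T →
      fderiv ℝ (gap j) z (c 0 • gapField j z 0 + c 1 • gapField j z 1) = y j := by
    intro j
    by_cases hj : j ∈ T
    · obtain ⟨κ, h0, h1, h2⟩ := fderiv_gap_gapField_self (hT j hj)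
      refine ⟨![y j 1 / κ, -(y j 0 / κ)], fun _ => ?_⟩
      ext e
      fin_cases e <;> simp [h1, h2] <;> field_simp
    · exact ⟨0, fun h => absurd h hj⟩
  choose c hc using this
  refine ⟨c, fun i hi => ?_⟩
  rw [map_sum, Finset.sum_eq_single i, hc i hi]
  · intro j hj hji
    simp [fderiv_gap_gapField_of_ne (hT i hi) (hT j hj) hji.symm]
  · exact fun h => absurd hi h

lemma eq_zero_of_omega {n : ℕ} {v : Phase n} (h : ∀ w, omega v w = 0) : v = 0 := by
  apply Prod.ext <;> ext j
  · simpa [omega, pdir, Pi.single_apply] using h (pdir j)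
  · simpa [omega, qdir, Pi.single_apply] using h (qdir j)

/-- The common kernel of the derivatives of the closed gap functions is symplectic. -/
lemma ker_gap_symplectic {n : ℕ} [NeZero n] {z : Phase n} {T : Finset (Fin (n - 1))}
    (hT : ∀ j ∈ T, gap j z = 0) {v : Phase n} (hv : ∀ j ∈ T, fderiv ℝ (gap j) z v = 0)
    (h : ∀ w, (∀ j ∈ T, fderiv ℝ (gap j) z w = 0) → omega v w = 0) : v = 0 := by
  refine eq_zero_of_omega fun w => ?_
  obtain ⟨c, hc⟩ := exists_fderiv_gap_eq hT fun i => fderiv ℝ (gap i) z w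
  set u := ∑ j ∈ T, (c j 0 • gapField j z 0 + c j 1 • gapField j z 1) with hu
  -- Subtracting u makes w tangent. The correction u itself is orthogonal to v, being a combination
  -- of Hamiltonian fields of functions whose derivatives kill v.
  have h1 : omega v (w + (-1 : ℝ) • u) = 0 :=
    h _ fun j hj => by rw [map_add, map_smul, hc j hj]; simp
  have h2 : omega u v = 0 := by
    have hlin : ∀ s : Finset (Fin (n - 1)), s ⊆ T →
        omega (∑ j ∈ s, (c j 0 • gapField j z 0 + c j 1 • gapField j z 1)) v = 0 := by
      intro s
      induction s using Finset.induction_on with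
      | empty => simp [omega]
      | insert j s hjs ih =>
        intro hs
        rw [Finset.sum_insert hjs, omega_add, ih fun i hi => hs (Finset.mem_insert_of_mem hi),
          omega_add, omega_smul, omega_smul, omega_gapField, omega_gapField,
          hv j (hs (Finset.mem_insert_self _ _))]
        simp
    exact hlin T subset_rfl
  rw [omega_swap, omega_add, omega_smul, h2, mul_zero, add_zero] at h1
  rw [omega_swap, h1]

end Toda

namespace Toda
open Matrix

/-! ### The characteristic polynomial of the Lax matrix -/

lemma det_shift (n : ℕ) [NeZero n] :
    (Matrix.of fun r s : Fin n => if r = s + 1 then (1 : ℝ) else 0).det = (-1) ^ (n - 1) := by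
  obtain ⟨k, rfl⟩ : ∃ k, n = k + 1 := ⟨n - 1, (Nat.succ_pred_eq_of_ne_zero (NeZero.ne n)).symm⟩
  have h : (Matrix.of fun r s : Fin (k + 1) => if r = s + 1 then (1 : ℝ) else 0) =
      ((finRotate (k + 1)).toPEquiv.toMatrix)ᵀ := by
    ext r s
    simp [PEquiv.toMatrix_apply, Matrix.transpose_apply, eq_comm]
  rw [h, Matrix.det_transpose, Matrix.det_permutation, sign_finRotate]
  simp

/-- The cyclic block shift built from the transfer matrices. -/
def cyclicTransfer {n : ℕ} [NeZero n] (z : Phase n) (x : ℝ) :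
    Matrix (Fin n × Fin 2) (Fin n × Fin 2) ℝ :=
  Matrix.of fun i j => if i.1 = j.1 + 1 then transfer z x j.1 i.2 j.2 else 0

/-- The part of `cyclicTransfer` below the diagonal. -/
def lowerTransfer {n : ℕ} [NeZero n] (z : Phase n) (x : ℝ) :
    Matrix (Fin n × Fin 2) (Fin n × Fin 2) ℝ :=
  Matrix.of fun i j => if (i.1 : ℕ) = j.1 + 1 then transfer z x j.1 i.2 j.2 else 0

lemma det_one_sub_lowerTransfer {n : ℕ} [NeZero n] (z : Phase n) (x : ℝ) :
    (1 - lowerTransfer z x).det = 1 := by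
  have hb : (1 - lowerTransfer z x).BlockTriangular (fun i => OrderDual.toDual i.1) := by
    intro i j hij
    have hij' : i.1 < j.1 := hij
    have h1 : i ≠ j := fun h => by simp [h] at hij'
    have h2 : ¬ (i.1 : ℕ) = j.1 + 1 := by have : (i.1 : ℕ) < j.1 := hij'; omega
    simp [lowerTransfer, Matrix.one_apply, h1, h2]
  rw [hb.det_fintype]
  refine Finset.prod_eq_one fun k _ => ?_
  have : (1 - lowerTransfer z x).toSquareBlock (fun i => OrderDual.toDual i.1) k = 1 := by
    ext i j
    have hij : i.1.1 = j.1.1 := by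
      have h1 := i.2
      have h2 := j.2
      exact OrderDual.toDual.injective (h1.trans h2.symm)
    simp [Matrix.toSquareBlock_def, lowerTransfer, Matrix.one_apply, hij, Subtype.ext_iff]
  rw [this, Matrix.det_one]

/-- Only the corner block distinguishes the cyclic shift from the lower triangular one. This is a
perturbation of rank at most two, so factoring out the unipotent part and using det(1 - WV) = det(1
- VW) leaves a 2×2 determinant. -/
lemma det_one_sub_cyclicTransfer {n : ℕ} [NeZero n] (z : Phase n) (x : ℝ) :
    (1 - cyclicTransfer z x).det = (1 - mono z x n).det := by
  obtain ⟨k, hk⟩ : ∃ k, n = k + 1 := ⟨n - 1, (Nat.succ_pred_eq_of_ne_zero (NeZero.ne n)).symm⟩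
  have hl : k < n := by omega
  set last : Fin n := Fin.ofNat n k with hlast
  have hlv : (last : ℕ) = k := by simp [hlast, Fin.ofNat, Nat.mod_eq_of_lt hl]
  set W : Matrix (Fin n × Fin 2) (Fin 2) ℝ :=
    Matrix.of fun i c => (mono z x i.1 * transfer z x last) i.2 c with hW
  set V : Matrix (Fin 2) (Fin n × Fin 2) ℝ :=
    Matrix.of fun c j => if j.1 = last ∧ c = j.2 then 1 else 0 with hV
  have hsucc : ∀ s : Fin n, s ≠ last → ((s + 1 : Fin n) : ℕ) = s + 1 := by
    intro s hs
    have h1 : (s : ℕ) ≠ k := fun h => hs (Fin.ext (h.trans hlv.symm))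
    have h2 := s.2
    rw [Fin.val_add, Fin.val_one']
    rw [Nat.add_mod_mod, Nat.mod_eq_of_lt (by omega)]
  have hlast1 : last + 1 = 0 := by
    apply Fin.ext
    rw [Fin.val_add, Fin.val_one', hlv, Nat.add_mod_mod]
    simp [hk]
  -- W is obtained by forward substitution: propagating the corner block through the sites produces
  -- the partial products `mono`.
  have hU : (1 - lowerTransfer z x) * W =
      Matrix.of fun i c => if i.1 = 0 then transfer z x last i.2 c else 0 := by
    ext ⟨r, a⟩ c
    rw [Matrix.sub_mul, Matrix.one_mul, Matrix.sub_apply]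
    simp only [Matrix.mul_apply, Fintype.sum_prod_type, lowerTransfer, Matrix.of_apply, hW]
    by_cases hr : r = 0
    · subst hr
      have : ∀ t : Fin n, ¬ ((0 : Fin n) : ℕ) = t + 1 := by intro t; simp
      simp [this, mono, Matrix.one_apply]
    · obtain ⟨m, hm⟩ : ∃ m, (r : ℕ) = m + 1 :=
        Nat.exists_eq_succ_of_ne_zero fun h => hr (Fin.ext h)
      have hmn : m < n := by have := r.2; omega
      have hmv : ((Fin.ofNat n m : Fin n) : ℕ) = m := by simp [Fin.ofNat, Nat.mod_eq_of_lt hmn]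
      rw [Finset.sum_eq_single (Fin.ofNat n m)]
      · rw [hmv, hm]
        simp only [if_true, hr, if_false, mono, Matrix.mul_apply, Fin.sum_univ_two]
        ring
      · intro t _ ht
        have : ¬ (r : ℕ) = t + 1 := fun h => ht (Fin.ext (by omega))
        simp [this]
      · simp
  have hfac : 1 - cyclicTransfer z x = (1 - lowerTransfer z x) * (1 - W * V) := by
    rw [Matrix.mul_sub, Matrix.mul_one, ← Matrix.mul_assoc, hU, sub_sub]
    congr 1
    ext ⟨r, a⟩ ⟨s, c⟩
    simp only [Matrix.add_apply, Matrix.mul_apply, Matrix.of_apply, cyclicTransfer, lowerTransfer,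
      hV, mul_ite, mul_one, mul_zero]
    by_cases hs : s = last
    · subst hs
      have h1 : ¬ (r : ℕ) = last + 1 := by have := r.2; omega
      rw [hlast1, if_neg h1, zero_add, Fin.sum_univ_two]
      fin_cases c <;> simp
    · have : r = s + 1 ↔ (r : ℕ) = s + 1 := by rw [Fin.ext_iff, hsucc s hs]
      simp [hs, this]
  rw [hfac, Matrix.det_mul, det_one_sub_lowerTransfer, one_mul, Matrix.det_one_sub_mul_comm]
  have hVW : V * W = mono z x k * transfer z x last := by
    ext c d
    simp only [Matrix.mul_apply, Fintype.sum_prod_type, hV, hW, Matrix.of_apply, ite_mul,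
      one_mul, zero_mul]
    rw [Finset.sum_eq_single last]
    · simp [hlv]
    · intro t _ ht; simp [ht]
    · simp
  rw [hVW, Matrix.det_one_sub_mul_comm, show mono z x n = mono z x (k + 1) from congrArg _ hk,
    mono]

/-- Eliminating the second component of each site by a Schur complement turns `1 - cyclicTransfer`
into a shift times x - L, conjugated by diag(e^{q_i/2}). Since det M = 1, det(1 - M) = 2 - tr M; the
shift accounts for the sign. -/
lemma det_sub_lax {n : ℕ} [NeZero n] (z : Phase n) (x : ℝ) :
    (x • (1 : Matrix (Fin n) (Fin n) ℝ) - lax z).det = (mono z x n).trace - 2 := by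
  have h1 : (1 - cyclicTransfer z x).det =
      (-(Matrix.of (fun r s : Fin n => if r = s + 1 then (1 : ℝ) else 0) *
        (Matrix.diagonal (fun i => Real.exp (-(z.1 i / 2))) *
          (x • (1 : Matrix (Fin n) (Fin n) ℝ) - lax z) *
            Matrix.diagonal (fun i => Real.exp (z.1 i / 2))))).det := by
    let e : Fin n ⊕ Fin n ≃ Fin n × Fin 2 :=
      { toFun := Sum.elim (fun r => (r, 0)) (fun r => (r, 1))
        invFun := fun i => if i.2 = 0 then Sum.inl i.1 else Sum.inr i.1
        left_inv := by rintro (r | r) <;> simp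
        right_inv := by rintro ⟨r, a⟩; fin_cases a <;> simp }
    rw [← Matrix.det_submatrix_equiv_self e]
    have h2 : (1 - cyclicTransfer z x).submatrix e e = Matrix.fromBlocks
        (1 - Matrix.of fun r s : Fin n => if r = s + 1 then x - z.2 s else 0)
        (Matrix.of fun r s : Fin n => if r = s + 1 then Real.exp (-z.1 s) else 0)
        (-Matrix.of fun r s : Fin n => if r = s + 1 then Real.exp (z.1 s) else 0) 1 := by
      ext (r | r) (s | s) <;>
        simp [e, cyclicTransfer, transfer, Matrix.one_apply] <;> split_ifs <;> simp
    rw [h2, Matrix.det_fromBlocks_one₂₂]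
    congr 1
    ext r s
    obtain ⟨t, rfl⟩ : ∃ t, r = t + 1 := ⟨r - 1, by simp⟩
    rw [Matrix.neg_apply, Matrix.mul_apply, Finset.sum_eq_single t]
    · simp only [Matrix.mul_neg, sub_neg_eq_add, Matrix.neg_apply, Matrix.add_apply, Matrix.sub_apply,
        Matrix.of_apply, add_left_inj, Matrix.mul_diagonal, Matrix.diagonal_mul, lax,
        Matrix.smul_apply, Matrix.one_apply, smul_eq_mul, if_true, one_mul, b]
      rw [Matrix.mul_apply, Finset.sum_eq_single t]
      · simp only [Matrix.of_apply, if_true]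
        have e1 : ∀ u : ℝ, Real.exp (-(u / 2)) * Real.exp (u / 2) = 1 := fun u => by
          rw [← Real.exp_add]; simp
        have e2 : ∀ u v : ℝ, Real.exp (-(u / 2)) * Real.exp ((u - v) / 2) * Real.exp (v / 2) = 1 :=
          fun u v => by
            rw [← Real.exp_add, ← Real.exp_add, Real.exp_eq_one_iff]; ring
        have e3 : ∀ u v : ℝ, Real.exp (-(u / 2)) * Real.exp ((v - u) / 2) * Real.exp (v / 2) =
            Real.exp (-u) * Real.exp v :=
          fun u v => by
            rw [← Real.exp_add, ← Real.exp_add, ← Real.exp_add]; ring_nf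
        have A1 : (if t = s then x - z.2 s else 0) = Real.exp (-(z.1 t / 2)) *
            (x * (if t = s then 1 else 0) - if t = s then z.2 t else 0) * Real.exp (z.1 s / 2) := by
          split_ifs with h
          · subst h
            linear_combination (-(x - z.2 t)) * e1 (z.1 t)
          · simp
        have A2 : (if t + 1 = s then (1 : ℝ) else 0) = Real.exp (-(z.1 t / 2)) *
            (if t + 1 = s then Real.exp ((z.1 t - z.1 (t + 1)) / 2) else 0) *
              Real.exp (z.1 s / 2) := by
          split_ifs with h
          · subst h
            rw [e2]
          · simp
        have A3 : Real.exp (-z.1 t) * (if t = s + 1 then Real.exp (z.1 s) else 0) =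
            Real.exp (-(z.1 t / 2)) *
            (if t = s + 1 then Real.exp ((z.1 s - z.1 (s + 1)) / 2) else 0) *
              Real.exp (z.1 s / 2) := by
          split_ifs with h
          · subst h
            rw [e3]
          · simp
        rw [A3, A2, A1]
        ring
      · intro u _ hu
        simp [hu.symm]
      · simp
    · intro u _ hu
      simp [hu.symm]
    · simp
  rw [det_one_sub_cyclicTransfer, Matrix.det_neg, Matrix.det_mul, Matrix.det_mul, Matrix.det_mul,
    det_shift, Matrix.det_diagonal, Matrix.det_diagonal, Fintype.card_fin] at h1
  have h3 : (∏ i, Real.exp (-(z.1 i / 2))) * ∏ i, Real.exp (z.1 i / 2) = 1 := by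
    rw [← Finset.prod_mul_distrib]
    exact Finset.prod_eq_one fun i _ => by rw [← Real.exp_add]; simp
  have h4 : (-1 : ℝ) ^ n * (-1) ^ (n - 1) = -1 := by
    obtain ⟨k, hk⟩ : ∃ k, n = k + 1 := ⟨n - 1, (Nat.succ_pred_eq_of_ne_zero (NeZero.ne n)).symm⟩
    rw [hk, Nat.add_sub_cancel, pow_succ]
    have : (-1 : ℝ) ^ k * (-1) ^ k = 1 := by rw [← mul_pow]; simp
    linear_combination -this
  have h5 := det_mono z x n
  rw [Matrix.det_fin_two] at h5 h1
  simp only [Matrix.sub_apply, Matrix.one_apply] at h1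
  simp at h1
  rw [Matrix.trace_fin_two]
  set d := (x • (1 : Matrix (Fin n) (Fin n) ℝ) - lax z).det
  set P1 := ∏ i, Real.exp (-(z.1 i / 2))
  set P2 := ∏ i, Real.exp (z.1 i / 2)
  linear_combination h1 - h5 + d * (P1 * P2) * h4 - d * h3

end Toda

namespace Toda
open Matrix

/-! ### Newton's identities along curves -/

/-- Elementary symmetric functions of the eigenvalues. -/
def esym {n : ℕ} (A : Matrix (Fin n) (Fin n) ℝ) (k : ℕ) : ℝ := A.charpoly.roots.esymm k

lemma esym_zero {n : ℕ} (A : Matrix (Fin n) (Fin n) ℝ) : esym A 0 = 1 := by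
  simp [esym, Multiset.esymm]

lemma trace_pow_eq_sum {n : ℕ} {A : Matrix (Fin n) (Fin n) ℝ} (hA : A.IsHermitian) (j : ℕ) :
    (A ^ j).trace = ∑ i, hA.eigenvalues i ^ j := by
  conv_lhs => rw [hA.spectral_theorem, ← map_pow, Unitary.conjStarAlgAut_apply,
    Matrix.trace_mul_cycle, Unitary.coe_star_mul_self, one_mul, Matrix.diagonal_pow,
    Matrix.trace_diagonal]
  simp

lemma esym_newton {n : ℕ} {A : Matrix (Fin n) (Fin n) ℝ} (hA : A.IsHermitian) (k : ℕ) :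
    k * esym A k = (-1) ^ (k + 1) * ∑ a ∈ Finset.HasAntidiagonal.antidiagonal k with a.1 < k,
      (-1) ^ a.1 * esym A a.1 * (A ^ a.2).trace := by
  have h := congrArg (MvPolynomial.aeval hA.eigenvalues) (MvPolynomial.mul_esymm_eq_sum (Fin n) ℝ k)
  have he : ∀ j, MvPolynomial.aeval hA.eigenvalues (MvPolynomial.esymm (Fin n) ℝ j) =
      esym A j := by
    intro j
    rw [MvPolynomial.aeval_esymm_eq_multiset_esymm, esym, hA.roots_charpoly_eq_eigenvalues]
    rfl
  have hp : ∀ j, MvPolynomial.aeval hA.eigenvalues (MvPolynomial.psum (Fin n) ℝ j) =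
      (A ^ j).trace := by
    intro j
    rw [trace_pow_eq_sum hA, MvPolynomial.psum]
    simp
  simp only [map_mul, map_natCast, map_pow, map_neg, map_one, map_sum, he, hp] at h
  exact h

lemma det_eq_sum_esym {n : ℕ} {A : Matrix (Fin n) (Fin n) ℝ} (hA : A.IsHermitian) (x : ℝ) :
    (x • (1 : Matrix (Fin n) (Fin n) ℝ) - A).det =
      ∑ k ∈ Finset.range (n + 1), (-1) ^ k * (esym A k * x ^ (n - k)) := by
  have h1 := Matrix.eval_charpoly A x
  have hc : A.charpoly.roots.card = n := by
    simp [hA.roots_charpoly_eq_eigenvalues]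
  have h2 : A.charpoly = (A.charpoly.roots.map fun t => Polynomial.X - Polynomial.C t).prod := by
    rw [hA.roots_charpoly_eq_eigenvalues, hA.charpoly_eq, Multiset.map_map]
    rfl
  rw [Matrix.scalar_apply, ← Matrix.smul_one_eq_diagonal] at h1
  rw [← h1, h2, Multiset.prod_X_sub_X_eq_sum_esymm, hc, Polynomial.eval_finsetSum]
  simp [esym]

lemma lax_isHermitian {n : ℕ} [NeZero n] (z : Phase n) : (lax z).IsHermitian := by
  ext r s
  simp only [lax, Matrix.conjTranspose_apply, Matrix.of_apply, star_trivial]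
  by_cases h : r = s
  · subst h; rfl
  · rw [if_neg h, if_neg (Ne.symm h)]
    simp only [zero_add, @eq_comm _ s, @eq_comm _ (s + 1)]
    rw [add_comm]

lemma contDiff_lax_pow {n : ℕ} [NeZero n] (j : ℕ) (r s : Fin n) :
    ContDiff ℝ ∞ fun z : Phase n => (lax z ^ j) r s := by
  induction j generalizing r s with
  | zero => simp only [pow_zero]; fun_prop
  | succ j ih =>
    simp only [pow_succ, Matrix.mul_apply]
    refine ContDiff.sum fun t _ => (ih _ _).mul ?_
    simp only [lax, Matrix.of_apply, b]
    split_ifs <;> fun_prop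

lemma contDiff_trace {n : ℕ} [NeZero n] (j : ℕ) :
    ContDiff ℝ ∞ fun z : Phase n => (lax z ^ j).trace := by
  simp only [Matrix.trace, Matrix.diag]
  exact ContDiff.sum fun t _ => contDiff_lax_pow j t t

lemma contDiff_integrals {n : ℕ} [NeZero n] : ContDiff ℝ ∞ (integrals (n := n)) := by
  rw [contDiff_pi]
  intro i
  exact contDiff_const.mul (contDiff_trace _)

lemma newton_deriv {p e : ℕ → ℝ → ℝ} (he0 : ∀ t, e 0 t = 1)
    (hN : ∀ k t, k * e k t = (-1) ^ (k + 1) * ∑ a ∈ Finset.HasAntidiagonal.antidiagonal k with a.1 < k,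
      (-1) ^ a.1 * e a.1 t * p a.2 t) {p' : ℕ → ℝ} (hp : ∀ j, HasDerivAt (p j) (p' j) 0) :
    ∃ e' : ℕ → ℝ, e' 0 = 0 ∧ (∀ k, HasDerivAt (e k) (e' k) 0) ∧
      ∀ k, k * e' k = (-1) ^ (k + 1) * ∑ a ∈ Finset.HasAntidiagonal.antidiagonal k with a.1 < k,
        (-1) ^ a.1 * (e' a.1 * p a.2 0 + e a.1 0 * p' a.2) := by
  -- In the application e k is a symmetric function of eigenvalues, not visibly smooth; the
  -- recursion expresses it through the differentiable power sums.
  have hd : ∀ k, DifferentiableAt ℝ (e k) 0 := by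
    intro k
    induction k using Nat.strong_induction_on with
    | _ k ih =>
      rcases Nat.eq_zero_or_pos k with rfl | hk
      · rw [show e 0 = fun _ => 1 from funext he0]
        exact differentiableAt_const _
      · have hk' : (k : ℝ) ≠ 0 := by positivity
        have h : e k = fun t => (k : ℝ)⁻¹ * ((-1) ^ (k + 1) *
            ∑ a ∈ Finset.HasAntidiagonal.antidiagonal k with a.1 < k, (-1) ^ a.1 * e a.1 t * p a.2 t) := by
          funext t
          rw [← hN]
          field_simp
        rw [h]
        refine ((DifferentiableAt.fun_sum fun a ha => ?_).const_mul _).const_mul _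
        have hlt := (Finset.mem_filter.1 ha).2
        exact ((ih _ hlt).const_mul _).fun_mul (hp _).differentiableAt
  refine ⟨fun k => deriv (e k) 0, ?_, fun k => (hd k).hasDerivAt, fun k => ?_⟩
  · simp [show e 0 = fun _ => 1 from funext he0]
  · have h1 : HasDerivAt (fun t => (k : ℝ) * e k t) (k * deriv (e k) 0) 0 :=
      (hd k).hasDerivAt.const_mul _
    have h2 : HasDerivAt (fun t => (-1 : ℝ) ^ (k + 1) *
        ∑ a ∈ Finset.HasAntidiagonal.antidiagonal k with a.1 < k, (-1) ^ a.1 * e a.1 t * p a.2 t)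
        ((-1) ^ (k + 1) * ∑ a ∈ Finset.HasAntidiagonal.antidiagonal k with a.1 < k,
          (((-1) ^ a.1 * deriv (e a.1) 0) * p a.2 0 + (-1) ^ a.1 * e a.1 0 * p' a.2)) 0 := by
      refine HasDerivAt.const_mul _ (HasDerivAt.fun_sum fun a _ => ?_)
      exact ((hd _).hasDerivAt.const_mul _).fun_mul (hp _)
    rw [funext (hN k)] at h1
    rw [h1.unique h2]
    congr 1
    exact Finset.sum_congr rfl fun a _ => by ring

/-- The differentiated Newton identities are triangular, with the term `p' k` entering with
coefficient ±1 because `e 0 = 1`. -/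
lemma newton_vanish {p e p' e' : ℕ → ℝ} (he0 : e 0 = 1) (he0' : e' 0 = 0)
    (h : ∀ k : ℕ, k * e' k = (-1) ^ (k + 1) * ∑ a ∈ Finset.HasAntidiagonal.antidiagonal k with a.1 < k,
        (-1) ^ a.1 * (e' a.1 * p a.2 + e a.1 * p' a.2)) (n : ℕ) :
    (∀ j, 1 ≤ j → j ≤ n → p' j = 0) ↔ ∀ k ≤ n, e' k = 0 := by
  constructor
  · intro hp k
    induction k using Nat.strong_induction_on with
    | _ k ih =>
      intro hk
      rcases Nat.eq_zero_or_pos k with rfl | hk0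
      · exact he0'
      have h1 := h k
      rw [Finset.sum_eq_zero, mul_zero] at h1
      · exact (mul_eq_zero.1 h1).resolve_left (by positivity)
      · intro a ha
        obtain ⟨h2, h3⟩ := Finset.mem_filter.1 ha
        rw [Finset.HasAntidiagonal.mem_antidiagonal] at h2
        rw [ih _ h3 (by omega), hp a.2 (by omega) (by omega)]
        simp
  · intro he j
    induction j using Nat.strong_induction_on with
    | _ j ih =>
      intro h1 hj
      have h2 := h j
      rw [he j hj, mul_zero, Finset.sum_eq_single (0, j)] at h2
      · simpa [he0, he0'] using h2
      · intro a ha hne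
        obtain ⟨h3, h4⟩ := Finset.mem_filter.1 ha
        rw [Finset.HasAntidiagonal.mem_antidiagonal] at h3
        have : a.1 ≠ 0 := fun h0 => hne (Prod.ext h0 (by simp; omega))
        rw [he _ (by omega), ih a.2 (by omega) (by omega) (by omega)]
        simp
      · intro hn
        exfalso
        apply hn
        simp
        omega

/-- The derivative of the discriminant in a direction `v` is a polynomial in the spectral
parameter, which vanishes if and only if the derivatives of the integrals do. -/
lemma exists_trace_dmono_eq {n : ℕ} [NeZero n] (z v : Phase n) :
    ∃ E : ℕ → ℝ, E 0 = 0 ∧ E 1 = ∑ i, v.2 i ∧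
      (∀ x, (dmono z x v 0 n).trace = ∑ k ∈ Finset.range (n + 1), (-1) ^ k * (E k * x ^ (n - k))) ∧
      (fderiv ℝ (integrals (n := n)) z v = 0 ↔ ∀ k ≤ n, E k = 0) := by
  have hline : HasDerivAt (fun t : ℝ => z + t • v) v 0 := by
    simpa using ((hasDerivAt_id (0 : ℝ)).smul_const v).const_add z
  have hz : z + (0 : ℝ) • v = z := by simp
  have hcomp : ∀ {f : Phase n → ℝ}, ContDiff ℝ ∞ f →
      HasDerivAt (fun t : ℝ => f (z + t • v)) (fderiv ℝ f z v) 0 := by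
    intro f hf
    have h1 : HasFDerivAt f (fderiv ℝ f z) (z + (0 : ℝ) • v) := by
      rw [hz]
      exact ((hf.differentiable (by simp)).differentiableAt).hasFDerivAt
    exact h1.comp_hasDerivAt 0 hline
  obtain ⟨E, hE0, hE, hN⟩ := newton_deriv (p := fun j t => (lax (z + t • v) ^ j).trace)
    (e := fun k t => esym (lax (z + t • v)) k) (fun t => esym_zero _)
    (fun k t => esym_newton (lax_isHermitian _) k)
    (p' := fun j => fderiv ℝ (fun z : Phase n => (lax z ^ j).trace) z v)
    (fun j => hcomp (contDiff_trace j))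
  refine ⟨E, hE0, ?_, ?_, ?_⟩
  · have h1 : ∀ y : Phase n, esym (lax y) 1 = (lax y).trace := by
      intro y
      have := esym_newton (lax_isHermitian y) 1
      simpa [Finset.Nat.antidiagonal_succ, Finset.sum_filter, esym_zero]
        using this
    -- The off-diagonal bonds reach the diagonal only when n = 1, where b = 1; they add a constant
    -- that differentiation removes.
    have h2 : ∀ y : Phase n, (lax y).trace = ∑ i, y.2 i +
        ∑ i : Fin n, ((if i + 1 = i then (1 : ℝ) else 0) + if i = i + 1 then (1 : ℝ) else 0) := by
      intro y
      rw [Matrix.trace, ← Finset.sum_add_distrib]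
      refine Finset.sum_congr rfl fun i _ => ?_
      simp only [Matrix.diag, lax, Matrix.of_apply, if_true, add_assoc]
      congr 1
      by_cases h : i + 1 = i
      · simp [h, b]
      · simp [h, Ne.symm h]
    have h3 := hE 1
    simp only [h1, h2] at h3
    have h4 : HasDerivAt (fun t : ℝ => ∑ i, (z + t • v).2 i +
        ∑ i : Fin n, ((if i + 1 = i then (1 : ℝ) else 0) + if i = i + 1 then (1 : ℝ) else 0))
        (∑ i, v.2 i) 0 := by
      refine HasDerivAt.add_const _ (HasDerivAt.fun_sum fun i _ => ?_)
      have := ((hasDerivAt_id (0 : ℝ)).mul_const (v.2 i)).const_add (z.2 i)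
      simpa using this
    exact h3.unique h4
  · intro x
    have h1 : ∀ y : Phase n, (mono y x n).trace =
        ∑ k ∈ Finset.range (n + 1), (-1) ^ k * (esym (lax y) k * x ^ (n - k)) + 2 := by
      intro y
      rw [← det_eq_sum_esym (lax_isHermitian y), det_sub_lax]
      ring
    have hm := fun r => hcomp (f := fun y : Phase n => mono y x n r r)
      ((contDiff_mono n r r).comp (contDiff_id.prodMk contDiff_const))
    have hfd : ∀ r, fderiv ℝ (fun y : Phase n => mono y x n r r) z v = dmono z x v 0 n r r := by
      intro r
      rw [← fderiv_mono]
      have h5 : HasFDerivAt (fun y : Phase n => mono y x n r r)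
          ((fderiv ℝ (fun w : Phase n × ℝ => mono w.1 w.2 n r r) (z, x)).comp
            ((ContinuousLinearMap.id ℝ (Phase n)).prod 0)) z :=
        (((contDiff_mono (n := n) n r r).differentiable
          (by simp)).differentiableAt (x := (z, x))).hasFDerivAt.comp (f := fun y => (y, x)) z
          ((hasFDerivAt_id z).prodMk (hasFDerivAt_const x z))
      rw [h5.fderiv]
      rfl
    have h2 : HasDerivAt (fun t : ℝ => (mono (z + t • v) x n).trace) (dmono z x v 0 n).trace 0 := by
      simp only [Matrix.trace_fin_two, ← hfd]
      exact (hm 0).fun_add (hm 1)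
    simp only [h1] at h2
    refine h2.unique (HasDerivAt.add_const _ (HasDerivAt.fun_sum fun k _ => ?_))
    exact ((hE k).mul_const _).const_mul _
  · have h1 := newton_vanish (p := fun j => (lax (z + (0 : ℝ) • v) ^ j).trace)
      (e := fun k => esym (lax (z + (0 : ℝ) • v)) k)
      (p' := fun j => fderiv ℝ (fun z : Phase n => (lax z ^ j).trace) z v) (esym_zero _) hE0 hN n
    rw [← h1]
    have hi : ∀ i : Fin n, fderiv ℝ (integrals (n := n)) z v i =
        (1 / ((i : ℕ) + 1 : ℝ)) * fderiv ℝ (fun z : Phase n => (lax z ^ ((i : ℕ) + 1)).trace) z v := by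
      intro i
      have hd := ((contDiff_integrals (n := n)).differentiable (by simp)).differentiableAt (x := z)
      have hp := hasFDerivAt_pi'.1 hd.hasFDerivAt i
      have ht := (((contDiff_trace (n := n) ((i : ℕ) + 1)).differentiable (by simp)).differentiableAt
        (x := z)).hasFDerivAt.const_mul (1 / ((i : ℕ) + 1 : ℝ))
      have h2 := congrArg (fun L : Phase n →L[ℝ] ℝ => L v) (hp.unique ht)
      simpa using h2
    constructor
    · intro h j hj1 hjn
      have h2 := hi ⟨j - 1, by omega⟩
      rw [h] at h2
      have h3 : j - 1 + 1 = j := by omega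
      simp only [Pi.zero_apply, h3] at h2
      refine (mul_eq_zero.1 h2.symm).resolve_left ?_
      positivity
    · intro h
      ext i
      rw [hi, h _ (by omega) (by omega)]
      simp

end Toda

namespace Toda
open Matrix

/-! ### The corank is the number of closed gaps -/

/-- Where M = σ is scalar, differentiating det M = 1 gives σ tr dM = 0. -/
lemma trace_dmono_of_closed {n : ℕ} [NeZero n] {j : Fin (n - 1)} {z : Phase n} (hj : gap j z = 0)
    (v : Phase n) : (dmono z (dirichlet j z) v 0 n).trace = 0 := by
  obtain ⟨σ, hσ0, hσ⟩ := gap_eq_zero hj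
  have h := dmono_det z (dirichlet j z) v 0 n
  simp [hσ] at h
  rw [Matrix.trace_fin_two]
  refine (mul_eq_zero.1 (?_ : σ * _ = 0)).resolve_left hσ0
  linear_combination h

/-- The linearization of the discriminant, in terms of its values at the Dirichlet spectrum and of
its leading coefficient. -/
def discrDeriv {n : ℕ} [NeZero n] (z : Phase n) : Phase n →ₗ[ℝ] ℝ × (Fin (n - 1) → ℝ) where
  toFun v := (∑ i, v.2 i, fun j => (dmono z (dirichlet j z) v 0 n).trace)
  map_add' v w := by
    ext <;> simp [Finset.sum_add_distrib, dmono_add']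
  map_smul' c v := by
    ext <;> simp [Finset.mul_sum, dmono_smul']

lemma fderiv_integrals_eq_zero_iff {n : ℕ} [NeZero n] (z v : Phase n) :
    fderiv ℝ (integrals (n := n)) z v = 0 ↔ discrDeriv z v = 0 := by
  obtain ⟨E, hE0, hE1, hE, hF⟩ := exists_trace_dmono_eq z v
  rw [hF]
  constructor
  · intro h
    apply Prod.ext
    · simpa [discrDeriv, hE1] using h 1 (NeZero.pos n)
    · funext j
      simp only [discrDeriv, LinearMap.coe_mk, AddHom.coe_mk, hE]
      refine Finset.sum_eq_zero fun k hk => ?_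
      rw [h k (by simpa [Nat.lt_succ_iff] using hk)]
      simp
  · intro h
    have h1 : E 1 = 0 := by
      rw [hE1]
      exact congrArg Prod.fst h
    have h2 : ∀ j : Fin (n - 1), (dmono z (dirichlet j z) v 0 n).trace = 0 := fun j =>
      congrFun (congrArg Prod.snd h) j
    set Q : Polynomial ℝ := ∑ k ∈ Finset.range (n + 1),
      Polynomial.C ((-1) ^ k * E k) * Polynomial.X ^ (n - k) with hQ
    have hev : ∀ x, Q.eval x = (dmono z x v 0 n).trace := by
      intro x
      rw [hE, hQ, Polynomial.eval_finsetSum]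
      exact Finset.sum_congr rfl fun k _ => by simp; ring
    have hco : ∀ k ≤ n, Q.coeff (n - k) = (-1) ^ k * E k := by
      intro k hk
      rw [hQ, Polynomial.finsetSum_coeff, Finset.sum_eq_single k]
      · rw [Polynomial.coeff_C_mul_X_pow, if_pos rfl]
      · intro l hl hlk
        have hl' : l ≤ n := by simpa [Nat.lt_succ_iff] using hl
        rw [Polynomial.coeff_C_mul_X_pow, if_neg (by omega)]
      · intro h
        exact absurd (Finset.mem_range.2 (by omega)) h
    -- `E 0 = 0` removes xⁿ and `E 1 = 0` removes xⁿ⁻¹, so the n - 1 Dirichlet zeros suffice to make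
    -- Q vanish.
    have hdeg : Q.degree < (n - 1 : ℕ) := by
      rw [Polynomial.degree_lt_iff_coeff_zero]
      intro m hm
      rcases Nat.lt_or_ge n m with hmn | hmn
      · rw [hQ, Polynomial.finsetSum_coeff]
        refine Finset.sum_eq_zero fun l _ => ?_
        rw [Polynomial.coeff_C_mul_X_pow, if_neg (by omega)]
      · have h3 := hco (n - m) (by omega)
        rw [show n - (n - m) = m by omega] at h3
        rw [h3]
        have : n - m = 0 ∨ n - m = 1 := by omega
        rcases this with h4 | h4 <;> simp [h4, hE0, h1]
    have hQ0 : Q = 0 := by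
      refine Polynomial.eq_zero_of_degree_lt_of_eval_finset_eq_zero (dirichletSet z) ?_ ?_
      · rwa [card_dirichletSet]
      · intro x hx
        have : x ∈ Set.range ((dirichletSet z).orderEmbOfFin (card_dirichletSet z)) := by
          rw [Finset.range_orderEmbOfFin]; exact hx
        obtain ⟨j, rfl⟩ := this
        rw [hev]
        exact h2 j
    intro k hk
    have h3 := hco k hk
    rw [hQ0, Polynomial.coeff_zero] at h3
    exact (mul_eq_zero.1 h3.symm).resolve_left (by simp)

/-- At an open gap there is a direction that moves the discriminant only at this gap. -/
lemma exists_discrDeriv_eq {n : ℕ} [NeZero n] {j : Fin (n - 1)} {z : Phase n}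
    (hj : gap j z ≠ 0) : ∃ v, discrDeriv z v = (0, Pi.single j 1) := by
  suffices h : ∃ v, ∃ κ : ℝ, κ ≠ 0 ∧ discrDeriv z v = (0, Pi.single j κ) by
    obtain ⟨v, κ, hκ, h⟩ := h
    refine ⟨κ⁻¹ • v, ?_⟩
    rw [map_smul, h, Prod.smul_mk, ← Pi.single_smul, smul_zero, smul_eq_mul, inv_mul_cancel₀ hκ]
  have hN := dmono_dirichlet_ne j z
  have hμ := fun i => mono_dirichlet i z
  have hsum : ∀ a b, ∑ i, (hvf z (dirichlet j z) n a b).2 i =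
      -dmono z (dirichlet j z) (qshift n) 0 n a b := by
    intro a b
    rw [← omega_hvf]
    simp [omega, qshift]
  have hne : ∀ i, i ≠ j → ∀ a b,
      (dirichlet j z - dirichlet i z) *
        (dmono z (dirichlet i z) (hvf z (dirichlet j z) n a b) 0 n).trace = 0 →
      (dmono z (dirichlet i z) (hvf z (dirichlet j z) n a b) 0 n).trace = 0 := by
    intro i hi a b h
    exact (mul_eq_zero.1 h).resolve_left
      (sub_ne_zero.2 fun h => hi ((dirichlet_strictMono z).injective h).symm)
  -- The Hamiltonian field of M₀₁ moves tr M at its own eigenvalue in proportion to M₀₀ - M₁₁, that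
  -- of M₀₀ in proportion to M₁₀; an open gap has one of these nonzero. At the other eigenvalues M₀₁
  -- = 0 makes both brackets vanish.
  by_cases h0 : mono z (dirichlet j z) n 0 0 - mono z (dirichlet j z) n 1 1 = 0
  · have h1 : mono z (dirichlet j z) n 1 0 ≠ 0 := by
      intro h1
      apply hj
      ext e
      fin_cases e <;> simp [gap, h0, h1]
    refine ⟨hvf z (dirichlet j z) n 0 0,
      -(mono z (dirichlet j z) n 1 0 * dmono z (dirichlet j z) 0 1 n 0 1), by simp [h1, hN], ?_⟩
    apply Prod.ext
    · change ∑ i, (hvf z (dirichlet j z) n 0 0).2 i = 0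
      rw [hsum, dmono_qshift, Matrix.sub_apply, Matrix.mul_apply, Matrix.mul_apply,
        Fin.sum_univ_two, Fin.sum_univ_two]
      simp
      ring
    · funext i
      change (dmono z (dirichlet i z) (hvf z (dirichlet j z) n 0 0) 0 n).trace =
        (Pi.single j _ : Fin (n - 1) → ℝ) i
      by_cases hij : i = j
      · subst hij
        rw [Pi.single_eq_same, Matrix.trace_fin_two, dmono_hvf_self, dmono_hvf_self, hμ]
        ring
      · rw [Pi.single_eq_of_ne hij]
        apply hne i hij
        rw [Matrix.trace_fin_two, mul_add, dmono_hvf z _ _ le_rfl, dmono_hvf z _ _ le_rfl, hμ, hμ]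
        ring
  · refine ⟨hvf z (dirichlet j z) n 0 1,
      (mono z (dirichlet j z) n 0 0 - mono z (dirichlet j z) n 1 1) *
        dmono z (dirichlet j z) 0 1 n 0 1, mul_ne_zero h0 hN, ?_⟩
    apply Prod.ext
    · change ∑ i, (hvf z (dirichlet j z) n 0 1).2 i = 0
      rw [hsum, dmono_qshift, Matrix.sub_apply, Matrix.mul_apply, Matrix.mul_apply,
        Fin.sum_univ_two, Fin.sum_univ_two]
      simp [hμ]
    · funext i
      change (dmono z (dirichlet i z) (hvf z (dirichlet j z) n 0 1) 0 n).trace =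
        (Pi.single j _ : Fin (n - 1) → ℝ) i
      by_cases hij : i = j
      · subst hij
        rw [Pi.single_eq_same, Matrix.trace_fin_two, dmono_hvf_self, dmono_hvf_self, hμ]
        ring
      · rw [Pi.single_eq_of_ne hij]
        apply hne i hij
        rw [Matrix.trace_fin_two, mul_add, dmono_hvf z _ _ le_rfl, dmono_hvf z _ _ le_rfl, hμ, hμ]
        ring

/-- The set of closed gaps. -/
def closedGaps {n : ℕ} [NeZero n] (z : Phase n) : Finset (Fin (n - 1)) :=
  Finset.univ.filter fun j => gap j z = 0

lemma mem_closedGaps {n : ℕ} [NeZero n] {z : Phase n} {j : Fin (n - 1)} :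
    j ∈ closedGaps z ↔ gap j z = 0 := by simp [closedGaps]

lemma range_discrDeriv {n : ℕ} [NeZero n] (z : Phase n) :
    (discrDeriv z).range = ((LinearMap.funLeft ℝ ℝ (Subtype.val : closedGaps z → Fin (n - 1))) ∘ₗ
      LinearMap.snd ℝ ℝ (Fin (n - 1) → ℝ)).ker := by
  apply le_antisymm
  · rintro _ ⟨v, rfl⟩
    rw [LinearMap.mem_ker]
    ext j
    exact trace_dmono_of_closed (mem_closedGaps.1 j.2) v
  · rintro ⟨c, x⟩ hx
    have hx' : ∀ j ∈ closedGaps z, x j = 0 := fun j hj => congrFun (LinearMap.mem_ker.1 hx) ⟨j, hj⟩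
    have hn : (n : ℝ) ≠ 0 := Nat.cast_ne_zero.2 (NeZero.ne n)
    have hs : ∀ j : Fin (n - 1), ∃ v, j ∉ closedGaps z → discrDeriv z v = (0, Pi.single j 1) := by
      intro j
      by_cases hj : j ∈ closedGaps z
      · exact ⟨0, fun h => absurd hj h⟩
      · obtain ⟨v, hv⟩ := exists_discrDeriv_eq (z := z) (j := j) (mt mem_closedGaps.2 hj)
        exact ⟨v, fun _ => hv⟩
    choose w hw using hs
    set u := discrDeriv z (pshift n) with hu
    have hu1 : u.1 = n := by simp [hu, discrDeriv, pshift]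
    have hu2 : ∀ j ∈ closedGaps z, u.2 j = 0 := fun j hj =>
      trace_dmono_of_closed (mem_closedGaps.1 hj) _
    -- The shift of momenta adjusts the leading coefficient; its effect at the open gaps is then
    -- corrected one gap at a time.
    refine ⟨(c / n) • pshift n +
      ∑ j ∈ (closedGaps z)ᶜ, (x j - c / n * u.2 j) • w j, ?_⟩
    rw [map_add, map_smul, map_sum, ← hu, Finset.sum_congr rfl (g := fun j =>
      ((0 : ℝ), (Pi.single j (x j - c / n * u.2 j) : Fin (n - 1) → ℝ)))]
    · apply Prod.ext
      · simp [Prod.fst_sum, hu1]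
      · funext i
        simp only [Prod.snd_add, Prod.smul_snd, Pi.add_apply, Pi.smul_apply, smul_eq_mul,
          Prod.snd_sum, Finset.sum_apply]
        by_cases hi : i ∈ closedGaps z
        · rw [hu2 i hi, hx' i hi, Finset.sum_eq_zero]
          · simp
          · intro j hj
            have : i ≠ j := fun h => (Finset.mem_compl.1 hj) (h ▸ hi)
            simp [this]
        · rw [Finset.sum_eq_single i]
          · simp
          · intro j _ hj
            simp [hj.symm]
          · intro h
            exact absurd (Finset.mem_compl.2 hi) h
    · intro j hj
      rw [map_smul, hw j (Finset.mem_compl.1 hj), Prod.smul_mk, ← Pi.single_smul]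
      simp

/-- `integrals` and `discrDeriv` have the same kernel and n-dimensional targets, so the codimension
of the range is the same, and each closed gap imposes one condition on the range of `discrDeriv`. -/
lemma corank_fderiv_integrals {n : ℕ} [NeZero n] (z : Phase n) :
    corank (fderiv ℝ (integrals (n := n)) z) = (closedGaps z).card := by
  set F := (fderiv ℝ (integrals (n := n)) z).toLinearMap with hF
  have hker : F.ker = (discrDeriv z).ker := by
    ext v
    exact fderiv_integrals_eq_zero_iff z v
  have h1 := F.finrank_range_add_finrank_ker
  have h2 := (discrDeriv z).finrank_range_add_finrank_ker
  rw [hker] at h1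
  have h3 := Submodule.finrank_quotient_add_finrank F.range
  rw [Module.finrank_fin_fun] at h3
  set R := (LinearMap.funLeft ℝ ℝ (Subtype.val : closedGaps z → Fin (n - 1))) ∘ₗ
      LinearMap.snd ℝ ℝ (Fin (n - 1) → ℝ) with hR
  have h4 := R.finrank_range_add_finrank_ker
  have h5 : R.range = ⊤ := by
    rw [LinearMap.range_eq_top, hR, LinearMap.coe_comp]
    exact (LinearMap.funLeft_surjective_of_injective ℝ ℝ _ Subtype.val_injective).comp
      Prod.snd_surjective
  rw [h5, finrank_top, ← range_discrDeriv, Module.finrank_prod, Module.finrank_fin_fun,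
    Module.finrank_self, Module.finrank_fintype_fun_eq_card, Fintype.card_coe] at h4
  have hn := NeZero.pos n
  change Module.finrank ℝ ((Fin n → ℝ) ⧸ F.range) = _
  omega

lemma singularSet_eq {n : ℕ} [NeZero n] (k : ℕ) :
    singularSet n k = {z | (closedGaps z).card = k} := by
  ext z
  simp [singularSet, corank_fderiv_integrals]

end Toda

namespace Toda

/-! ### The strata are symplectic submanifolds -/

/-- If R is a right inverse of A, then B ∘ R is invertible for every B near A. -/
lemma isOpen_setOf_surjective {E F : Type*} [NormedAddCommGroup E] [NormedSpace ℝ E]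
    [NormedAddCommGroup F] [NormedSpace ℝ F] [FiniteDimensional ℝ F] :
    IsOpen {A : E →L[ℝ] F | Function.Surjective A} := by
  have : CompleteSpace F := FiniteDimensional.complete ℝ F
  rw [isOpen_iff_mem_nhds]
  intro A hA
  obtain ⟨R, hR⟩ := A.toLinearMap.exists_rightInverse_of_surjective (LinearMap.range_eq_top.2 hA)
  let R' : F →L[ℝ] E := LinearMap.toContinuousLinearMap R
  have hc : Continuous fun B : E →L[ℝ] F => B.comp R' := by fun_prop
  have h1 : A.comp R' = 1 := by
    ext x
    exact congrArg (fun L : F →ₗ[ℝ] F => L x) hR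
  have h2 : IsOpen {B : E →L[ℝ] F | IsUnit (B.comp R')} :=
    (Units.isOpen (R := F →L[ℝ] F)).preimage hc
  filter_upwards [h2.mem_nhds (show IsUnit (A.comp R') by rw [h1]; exact isUnit_one)] with B hB
  obtain ⟨u, hu⟩ := hB
  intro y
  refine ⟨R' ((↑u⁻¹ : F →L[ℝ] F) y), ?_⟩
  have h3 := congrArg (fun L : F →L[ℝ] F => L y) u.mul_inv
  rw [hu] at h3
  exact h3

lemma isClosed_gap {n : ℕ} [NeZero n] (j : Fin (n - 1)) :
    IsClosed {z : Phase n | gap j z = 0} :=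
  isClosed_eq (contDiff_gap j).continuous continuous_const

lemma isOpen_closedGaps_subset {n : ℕ} [NeZero n] (T : Finset (Fin (n - 1))) :
    IsOpen {z : Phase n | closedGaps z ⊆ T} := by
  have : {z : Phase n | closedGaps z ⊆ T} = ⋂ j ∈ Tᶜ, {z : Phase n | gap j z = 0}ᶜ := by
    ext z
    simp only [Set.mem_ofPred_eq, Set.mem_iInter, Set.mem_compl_iff, Finset.mem_compl]
    exact ⟨fun h j hj hz => hj (h (mem_closedGaps.2 hz)), fun h j hj => by
      by_contra hjT
      exact h j hjT (mem_closedGaps.1 hj)⟩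
  rw [this]
  exact isOpen_biInter_finset fun j _ => (isClosed_gap j).isOpen_compl

/-- The gap functions with labels in `T`, taken together. -/
def gapMap {n : ℕ} [NeZero n] (T : Finset (Fin (n - 1))) (z : Phase n) : T → Fin 2 → ℝ :=
  fun j => gap j z

lemma contDiff_gapMap {n : ℕ} [NeZero n] (T : Finset (Fin (n - 1))) :
    ContDiff ℝ ∞ (gapMap (n := n) T) := by
  rw [contDiff_pi]
  intro j
  exact contDiff_gap (j : Fin (n - 1))

lemma fderiv_gapMap {n : ℕ} [NeZero n] (T : Finset (Fin (n - 1))) (z v : Phase n) (j : T) :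
    fderiv ℝ (gapMap T) z v j = fderiv ℝ (gap j) z v := by
  have hd := (((contDiff_gapMap T).differentiable (by simp)).differentiableAt (x := z)).hasFDerivAt
  have h1 := (hasFDerivAt_pi'.1 hd j).fderiv
  have h2 := congrArg (fun L : Phase n →L[ℝ] (Fin 2 → ℝ) => L v) h1
  exact h2.symm

lemma surjective_fderiv_gapMap {n : ℕ} [NeZero n] {z : Phase n} {T : Finset (Fin (n - 1))}
    (hT : T ⊆ closedGaps z) : Function.Surjective (fderiv ℝ (gapMap T) z) := by
  intro y
  obtain ⟨c, hc⟩ := exists_fderiv_gap_eq (fun j hj => mem_closedGaps.1 (hT hj))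
    (fun j => if h : j ∈ T then y ⟨j, h⟩ else 0)
  refine ⟨∑ j ∈ T, (c j 0 • gapField j z 0 + c j 1 • gapField j z 1), ?_⟩
  ext1 j
  rw [fderiv_gapMap, hc j j.2, dif_pos j.2]

/-- Open gaps stay open nearby, so close to z the corank is k exactly when all gaps of T remain
closed; the 2k gap functions of T are the defining map. -/
lemma isSymplecticSubmanifold_singularSet {n : ℕ} [NeZero n] (k : ℕ) :
    IsSymplecticSubmanifold (singularSet n k) (2 * k) := by
  intro z hz
  replace hz : (closedGaps z).card = k := by rwa [singularSet_eq] at hz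
  set T := closedGaps z with hT
  have hcard : Fintype.card (T × Fin 2) = 2 * k := by
    rw [Fintype.card_prod, Fintype.card_coe, hz, Fintype.card_fin, mul_comm]
  let e : T × Fin 2 ≃ Fin (2 * k) := Fintype.equivFinOfCardEq hcard
  let L : (T → Fin 2 → ℝ) ≃ₗ[ℝ] (Fin (2 * k) → ℝ) :=
    (LinearEquiv.curry ℝ ℝ T (Fin 2)).symm.trans (LinearEquiv.funCongrLeft ℝ ℝ e.symm)
  let L' : (T → Fin 2 → ℝ) ≃L[ℝ] (Fin (2 * k) → ℝ) := L.toContinuousLinearEquiv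
  have hfd : ∀ y, fderiv ℝ (L' ∘ gapMap T) y =
      (L' : (T → Fin 2 → ℝ) →L[ℝ] (Fin (2 * k) → ℝ)).comp (fderiv ℝ (gapMap T) y) := fun y =>
    L'.comp_fderiv
  have hsub : ∀ y, closedGaps y ⊆ T → ((closedGaps y).card = k ↔ (L' ∘ gapMap T) y = 0) := by
    intro y hy
    rw [Function.comp_apply, map_eq_zero_iff L' L'.injective]
    constructor
    · intro h
      have := Finset.eq_of_subset_of_card_le hy (by rw [h, ← hz])
      funext j
      exact mem_closedGaps.1 (this.symm.subset j.2)
    · intro h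
      have : T ⊆ closedGaps y := fun j hj => mem_closedGaps.2 (congrFun h ⟨j, hj⟩)
      rw [subset_antisymm hy this, hz]
  refine ⟨{y | closedGaps y ⊆ T} ∩ {y | Function.Surjective (fderiv ℝ (gapMap T) y)},
    L' ∘ gapMap T, ⟨Finset.Subset.refl T, surjective_fderiv_gapMap (Finset.Subset.refl T)⟩, ⟨?_, ?_, ?_, ?_⟩, ?_⟩
  · exact (isOpen_closedGaps_subset T).inter (isOpen_setOf_surjective.preimage
      ((contDiff_gapMap T).continuous_fderiv (by simp)))
  · exact (L'.contDiff.comp (contDiff_gapMap T)).contDiffOn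
  · intro y hy
    rw [hfd]
    exact L'.surjective.comp hy.2
  · rw [singularSet_eq]
    ext y
    simp only [Set.mem_inter_iff, Set.mem_ofPred_eq]
    constructor
    · rintro ⟨h1, h2⟩
      exact ⟨h2, (hsub y h2.1).1 h1⟩
    · rintro ⟨h1, h2⟩
      exact ⟨(hsub y h1.1).2 h2, h1⟩
  · have hker : ∀ v, fderiv ℝ (L' ∘ gapMap T) z v = 0 ↔ ∀ j ∈ T, fderiv ℝ (gap j) z v = 0 := by
      intro v
      rw [hfd]
      simp only [ContinuousLinearMap.coe_comp, Function.comp_apply]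
      rw [ContinuousLinearEquiv.coe_coe, map_eq_zero_iff L' L'.injective]
      constructor
      · intro h j hj
        rw [← fderiv_gapMap T z v ⟨j, hj⟩, h]
        rfl
      · intro h
        funext j
        rw [fderiv_gapMap, h j j.2]
        rfl
    intro v hv h
    refine ker_gap_symplectic (T := T) (fun j hj => mem_closedGaps.1 hj) ((hker v).1 hv) ?_
    exact fun w hw => h w ((hker w).2 hw)

/-! ### Local structure of the strata -/

/-- The set where exactly the gaps in `S` are closed. -/
def stratum {n : ℕ} [NeZero n] (S : Finset (Fin (n - 1))) : Set (Phase n) :=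
  {z | closedGaps z = S}

/-- Polar coordinates. That each gap imposes two real conditions, not one, is what keeps the
complement connected. -/
lemma isPreconnected_ball_diff_zero (r : ℝ) :
    IsPreconnected (Metric.ball (0 : Fin 2 → ℝ) r \ {0}) := by
  have h : Metric.ball (0 : Fin 2 → ℝ) r \ {0} =
      (fun w : ℝ × (Fin 2 → ℝ) => w.1 • w.2) '' (Set.Ioo 0 r ×ˢ Metric.sphere 0 1) := by
    ext x
    simp only [Set.mem_sdiff, mem_ball_zero_iff, Set.mem_singleton_iff, Set.mem_image, Set.mem_prod,
      Set.mem_Ioo, mem_sphere_zero_iff_norm, Prod.exists]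
    constructor
    · rintro ⟨h1, h2⟩
      have h3 : ‖x‖ ≠ 0 := norm_ne_zero_iff.2 h2
      refine ⟨‖x‖, ‖x‖⁻¹ • x, ⟨⟨norm_pos_iff.2 h2, h1⟩, ?_⟩, smul_inv_smul₀ h3 x⟩
      rw [norm_smul, norm_inv, norm_norm, inv_mul_cancel₀ h3]
    · rintro ⟨t, y, ⟨⟨h1, h2⟩, h3⟩, rfl⟩
      constructor
      · rwa [norm_smul, h3, mul_one, Real.norm_of_nonneg h1.le]
      · rw [smul_eq_zero, not_or]
        exact ⟨h1.ne', fun h => by simp [h] at h3⟩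
  rw [h]
  refine (isPreconnected_Ioo.prod (isPreconnected_sphere ?_ 0 1)).image _ (by fun_prop)
  simp

/-- After straightening the submersion `gapMap T`, a gap of T contributes a point if it lies in S
and a punctured disc otherwise, while the kernel directions contribute a ball. -/
lemma exists_isPreconnected_inter_stratum {n : ℕ} [NeZero n] {z : Phase n}
    {S : Finset (Fin (n - 1))} (hS : S ⊆ closedGaps z) {O : Set (Phase n)} (hO : O ∈ nhds z) :
    ∃ V ∈ nhds z, V ⊆ O ∧ IsPreconnected (V ∩ stratum S) ∧ (V ∩ stratum S).Nonempty := by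
  classical
  set T := closedGaps z with hT
  have hf : HasStrictFDerivAt (gapMap T) (fderiv ℝ (gapMap T) z) z :=
    (contDiff_gapMap T).contDiffAt.hasStrictFDerivAt (by simp)
  have hf' : (fderiv ℝ (gapMap T) z).range = ⊤ :=
    LinearMap.range_eq_top.2 (surjective_fderiv_gapMap subset_rfl)
  set φ := hf.implicitToOpenPartialHomeomorph (gapMap T) _ hf' with hφ
  have hfst : ∀ y, (φ y).1 = gapMap T y := fun y => hf.implicitToOpenPartialHomeomorph_fst hf' y
  have hz0 : gapMap T z = 0 := funext fun j => mem_closedGaps.1 j.2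
  have hφz : φ z = (0, 0) := by
    rw [hφ, hf.implicitToOpenPartialHomeomorph_self hf', hz0]
  have hzs : z ∈ φ.source := hf.mem_implicitToOpenPartialHomeomorph_source hf'
  have hN : O ∩ {y | closedGaps y ⊆ T} ∈ nhds z :=
    Filter.inter_mem hO ((isOpen_closedGaps_subset T).mem_nhds (Finset.Subset.refl T))
  have hsymm : φ.symm (0, 0) = z := by rw [← hφz, φ.left_inv hzs]
  have htz : ((0, 0) : (T → Fin 2 → ℝ) × _) ∈ φ.target := hφz ▸ φ.map_source hzs
  have hpre : φ.target ∩ φ.symm ⁻¹' (O ∩ {y | closedGaps y ⊆ T}) ∈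
      nhds ((0, 0) : (T → Fin 2 → ℝ) × _) := by
    refine Filter.inter_mem (φ.open_target.mem_nhds htz) ?_
    have hc := φ.symm.continuousAt (x := (0, 0)) htz
    rw [ContinuousAt, hsymm] at hc
    exact hc hN
  obtain ⟨r, hr, hball⟩ := Metric.mem_nhds_iff.1 hpre
  rw [← ball_prod_same] at hball
  set B := Metric.ball (0 : T → Fin 2 → ℝ) r ×ˢ
    Metric.ball (0 : (fderiv ℝ (gapMap T) z).ker) r with hB
  set C := (Set.univ.pi fun j : T => if (j : Fin (n - 1)) ∈ S then ({0} : Set (Fin 2 → ℝ)) else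
    Metric.ball 0 r \ {0}) ×ˢ Metric.ball (0 : (fderiv ℝ (gapMap T) z).ker) r with hC
  have hCB : C ⊆ B := by
    rintro ⟨x, w⟩ ⟨hx, hw⟩
    refine ⟨?_, hw⟩
    rw [ball_pi _ hr]
    intro j hj
    have := hx j hj
    change x j ∈ Metric.ball (0 : Fin 2 → ℝ) r
    dsimp only at this
    split_ifs at this with h
    · rw [Set.mem_singleton_iff.1 this]
      exact Metric.mem_ball_self hr
    · exact this.1
  have hV : φ.source ∩ φ ⁻¹' B ∈ nhds z := by
    refine Filter.inter_mem (φ.open_source.mem_nhds hzs) ?_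
    refine (φ.continuousAt hzs).preimage_mem_nhds ?_
    rw [hφz, hB, ball_prod_same]
    exact Metric.ball_mem_nhds _ hr
  have himage : φ.source ∩ φ ⁻¹' B ∩ stratum S = φ.symm '' C := by
    ext y
    constructor
    · rintro ⟨⟨hy, hyB⟩, hyS⟩
      refine ⟨φ y, ⟨?_, hyB.2⟩, φ.left_inv hy⟩
      intro j _
      have h1 : (φ y).1 j = gap j y := by rw [hfst]; rfl
      have h2 : gap (j : Fin (n - 1)) y = 0 ↔ (j : Fin (n - 1)) ∈ S := by
        rw [← mem_closedGaps, show closedGaps y = S from hyS]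
      have h3 : (φ y).1 j ∈ Metric.ball (0 : Fin 2 → ℝ) r := by
        have := hyB.1
        rw [ball_pi _ hr] at this
        exact this j trivial
      dsimp only
      split_ifs with h
      · rw [h1, h2.2 h]
        rfl
      · exact ⟨h3, fun h0 => h (h2.1 (h1 ▸ h0))⟩
    · rintro ⟨c, hc, rfl⟩
      have hct := hball (hCB hc)
      have hφc : φ (φ.symm c) = c := φ.right_inv hct.1
      refine ⟨⟨φ.map_target hct.1, ?_⟩, ?_⟩
      · rw [Set.mem_preimage, hφc]
        exact hCB hc
      · have hsub : closedGaps (φ.symm c) ⊆ T := hct.2.2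
        have hg : ∀ j : T, gap j (φ.symm c) = c.1 j := by
          intro j
          rw [← hφc, hfst, hφc]
          rfl
        ext j
        rw [mem_closedGaps]
        constructor
        · intro h
          have hjT := hsub (mem_closedGaps.2 h)
          by_contra hjS
          have := hc.1 ⟨j, hjT⟩ trivial
          dsimp only at this
          rw [if_neg hjS, ← hg ⟨j, hjT⟩] at this
          exact this.2 h
        · intro hjS
          have := hc.1 ⟨j, hS hjS⟩ trivial
          dsimp only at this
          rw [if_pos hjS, ← hg ⟨j, hS hjS⟩] at this
          exact this
  refine ⟨φ.source ∩ φ ⁻¹' B, hV, ?_, ?_, ?_⟩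
  · rintro y ⟨hy, hyB⟩
    have := (hball hyB).2.1
    rwa [φ.left_inv hy] at this
  · rw [himage]
    refine IsPreconnected.image ?_ _ (φ.symm.continuousOn.mono fun c hc => (hball (hCB hc)).1)
    refine (isPreconnected_univ_pi fun j => ?_).prod (convex_ball _ _).isPreconnected
    split_ifs
    · exact isPreconnected_singleton
    · exact isPreconnected_ball_diff_zero r
  · rw [himage]
    refine Set.Nonempty.image _ ⟨(fun j => if (j : Fin (n - 1)) ∈ S then 0 else fun _ => r / 2, 0),
      fun j _ => ?_, Metric.mem_ball_self hr⟩
    dsimp only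
    split_ifs with h
    · rfl
    · have hr2 : ‖(fun _ : Fin 2 => r / 2)‖ = r / 2 := by
        rw [pi_norm_const, Real.norm_of_nonneg (by positivity)]
      refine ⟨?_, fun h0 => ?_⟩
      · rw [mem_ball_zero_iff, hr2]
        linarith
      · rw [Set.mem_singleton_iff.1 h0, norm_zero] at hr2
        linarith

end Toda

namespace Toda

/-! ### A proper energy function -/

/-- The energy of the Toda chain plus the square of the center of mass. -/
def energy {n : ℕ} [NeZero n] (z : Phase n) : ℝ :=
  1 / 2 * ∑ i, z.2 i ^ 2 + ∑ i, Real.exp (z.1 i - z.1 (i + 1)) + (∑ i, z.1 i) ^ 2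

lemma contDiff_energy {n : ℕ} [NeZero n] : ContDiff ℝ ∞ (energy (n := n)) := by
  unfold energy
  fun_prop

lemma sum_shift {n : ℕ} [NeZero n] (z : Phase n) (w : Fin n → ℝ) :
    ∑ i, Real.exp (z.1 (i - 1) - z.1 i) * w i =
      ∑ i, Real.exp (z.1 i - z.1 (i + 1)) * w (i + 1) := by
  rw [← Equiv.sum_comp (Equiv.addRight (1 : Fin n))]
  simp

lemma fderiv_energy {n : ℕ} [NeZero n] (z w : Phase n) :
    fderiv ℝ (energy (n := n)) z w =
      omega (todaField z) w + 2 * (∑ i, z.1 i) * ∑ i, w.1 i := by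
  have hline : HasDerivAt (fun t : ℝ => z + t • w) w 0 := by
    simpa using ((hasDerivAt_id (0 : ℝ)).smul_const w).const_add z
  have hcomp : ∀ {f : Phase n → ℝ}, ContDiff ℝ ∞ f →
      HasDerivAt (fun t : ℝ => f (z + t • w)) (fderiv ℝ f z w) 0 := fun {f} hf => by
    have h1 : HasFDerivAt f (fderiv ℝ f z) (z + (0 : ℝ) • w) := by
      rw [zero_smul, add_zero]
      exact ((hf.differentiable (by simp)).differentiableAt).hasFDerivAt
    exact h1.comp_hasDerivAt 0 hline
  have h2 := hcomp (f := energy) contDiff_energy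
  have hq : ∀ i, HasDerivAt (fun t : ℝ => z.1 i + t * w.1 i) (w.1 i) 0 := fun i => by
    simpa using ((hasDerivAt_id (0 : ℝ)).mul_const (w.1 i)).const_add (z.1 i)
  have hp : ∀ i, HasDerivAt (fun t : ℝ => z.2 i + t * w.2 i) (w.2 i) 0 := fun i => by
    simpa using ((hasDerivAt_id (0 : ℝ)).mul_const (w.2 i)).const_add (z.2 i)
  have h3 := (((HasDerivAt.fun_sum fun i (_ : i ∈ Finset.univ) => (hp i).fun_pow 2).const_mul
    (1 / 2 : ℝ)).fun_add (HasDerivAt.fun_sum fun i (_ : i ∈ Finset.univ) =>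
      ((hq i).fun_sub (hq (i + 1))).exp)).fun_add
      ((HasDerivAt.fun_sum fun i (_ : i ∈ Finset.univ) => hq i).fun_pow 2)
  have h4 := h2.unique h3
  rw [h4]
  simp only [zero_mul, add_zero, omega, todaField, Finset.sum_sub_distrib, sub_mul, mul_sub,
    sum_shift]
  have h5 : (1 / 2 : ℝ) * ∑ i, ((2 : ℕ) : ℝ) * z.2 i ^ (2 - 1) * w.2 i = ∑ i, z.2 i * w.2 i := by
    rw [Finset.mul_sum]
    exact Finset.sum_congr rfl fun i _ => by push_cast; ring
  rw [h5]
  push_cast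
  ring

/-- The exponentials bound each q_i - q_{i+1} from above; going around the cycle bounds all
differences on both sides, and the square of the center of mass controls the remaining translation.
-/
lemma isCompact_energy_le {n : ℕ} [NeZero n] (c : ℝ) : IsCompact {z : Phase n | energy z ≤ c} := by
  have hcl : IsClosed {z : Phase n | energy z ≤ c} :=
    isClosed_le contDiff_energy.continuous continuous_const
  refine (isCompact_closedBall (0 : Phase n) (n * c + 2 * c + 2)).of_isClosed_subset hcl ?_
  intro z hz
  have hz' : energy z ≤ c := hz
  have hn : (1 : ℝ) ≤ n := Nat.one_le_cast.2 (NeZero.pos n)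
  have hp : 0 ≤ ∑ i, z.2 i ^ 2 := Finset.sum_nonneg fun _ _ => sq_nonneg _
  have he : 0 ≤ ∑ i, Real.exp (z.1 i - z.1 (i + 1)) :=
    Finset.sum_nonneg fun _ _ => (Real.exp_pos _).le
  have hQ := sq_nonneg (∑ i, z.1 i)
  unfold energy at hz'
  have hc : 0 ≤ c := by linarith
  have hpi : ∀ i, |z.2 i| ≤ 2 * c + 1 := by
    intro i
    have h1 : z.2 i ^ 2 ≤ ∑ i, z.2 i ^ 2 :=
      Finset.single_le_sum (f := fun i => z.2 i ^ 2) (fun _ _ => sq_nonneg _) (Finset.mem_univ i)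
    rw [abs_le]
    constructor <;> nlinarith
  have hstep : ∀ i, z.1 i - z.1 (i + 1) ≤ c := by
    intro i
    have h1 : Real.exp (z.1 i - z.1 (i + 1)) ≤ ∑ i, Real.exp (z.1 i - z.1 (i + 1)) :=
      Finset.single_le_sum (f := fun i => Real.exp (z.1 i - z.1 (i + 1)))
        (fun _ _ => (Real.exp_pos _).le) (Finset.mem_univ i)
    have h2 := Real.add_one_le_exp (z.1 i - z.1 (i + 1))
    linarith
  have hiter : ∀ (m : ℕ) (i : Fin n), z.1 i - z.1 (i + Fin.ofNat n m) ≤ m * c := by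
    intro m i
    induction m with
    | zero =>
      have : Fin.ofNat n 0 = 0 := by apply Fin.ext; simp [Fin.ofNat]
      rw [this]
      simp
    | succ m ih =>
      have : Fin.ofNat n (m + 1) = Fin.ofNat n m + 1 := by
        apply Fin.ext
        simp [Fin.ofNat, Fin.val_add]
      rw [this, ← add_assoc]
      have := hstep (i + Fin.ofNat n m)
      push_cast
      linarith
  have hdiff : ∀ i k : Fin n, z.1 i - z.1 k ≤ n * c := by
    intro i k
    have h1 := hiter (k - i).val i
    have h2 : Fin.ofNat n (k - i).val = k - i := by
      apply Fin.ext
      simp [Fin.ofNat, Nat.mod_eq_of_lt (k - i).2]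
    rw [h2, add_sub_cancel] at h1
    have h3 : ((k - i).val : ℝ) ≤ n := Nat.cast_le.2 (k - i).2.le
    nlinarith
  have hQ' : |∑ i, z.1 i| ≤ c + 1 := by
    rw [abs_le]
    constructor <;> nlinarith
  rw [abs_le] at hQ'
  have hqi : ∀ i, |z.1 i| ≤ n * c + c + 1 := by
    intro i
    have h1 : ∑ k, (z.1 i - z.1 k) ≤ ∑ _k : Fin n, n * c := Finset.sum_le_sum fun k _ => hdiff i k
    have h2 : ∑ k, (z.1 k - z.1 i) ≤ ∑ _k : Fin n, n * c := Finset.sum_le_sum fun k _ => hdiff k i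
    simp only [Finset.sum_sub_distrib, Finset.sum_const, Finset.card_univ, Fintype.card_fin,
      nsmul_eq_mul] at h1 h2
    rw [abs_le]
    constructor
    · by_contra h
      push Not at h
      nlinarith
    · by_contra h
      push Not at h
      nlinarith
  rw [mem_closedBall_zero_iff, Prod.norm_def]
  refine max_le ?_ ?_
  · rw [pi_norm_le_iff_of_nonneg (by positivity)]
    intro i
    have := hqi i
    rw [Real.norm_eq_abs]
    linarith
  · rw [pi_norm_le_iff_of_nonneg (by positivity)]
    intro i
    have := hpi i
    rw [Real.norm_eq_abs]
    nlinarith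

/-! ### The equilibrium -/

/-- At an equilibrium all q_i - q_{i+1} agree, and they sum to zero around the cycle. -/
lemma eq_zero_of_todaField {n : ℕ} [NeZero n] {z : Phase n} (h : todaField z = 0)
    (hQ : ∑ i, z.1 i = 0) : z = 0 := by
  have hp : z.2 = 0 := congrArg Prod.fst h
  have hstep : ∀ i, z.1 i - z.1 (i + 1) = z.1 (i - 1) - z.1 i := by
    intro i
    have h1 := congrFun (congrArg Prod.snd h) i
    exact Real.exp_injective (sub_eq_zero.1 h1).symm
  have hconst : ∀ m : ℕ, z.1 (Fin.ofNat n m) - z.1 (Fin.ofNat n m + 1) = z.1 0 - z.1 (0 + 1) := by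
    intro m
    induction m with
    | zero =>
      have : Fin.ofNat n 0 = 0 := by apply Fin.ext; simp [Fin.ofNat]
      rw [this]
    | succ m ih =>
      have : Fin.ofNat n (m + 1) = Fin.ofNat n m + 1 := by
        apply Fin.ext
        simp [Fin.ofNat, Fin.val_add]
      rw [this, hstep, add_sub_cancel_right, ih]
  set d := z.1 0 - z.1 (0 + 1) with hd
  have hall : ∀ i : Fin n, z.1 i - z.1 (i + 1) = d := by
    intro i
    have h2 : Fin.ofNat n i.val = i := by
      apply Fin.ext
      simp [Fin.ofNat, Nat.mod_eq_of_lt i.2]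
    rw [← h2]
    exact hconst _
  have hn : (n : ℝ) ≠ 0 := Nat.cast_ne_zero.2 (NeZero.ne n)
  have hd0 : d = 0 := by
    have h1 : ∑ i, (z.1 i - z.1 (i + 1)) = ∑ _i : Fin n, d := Finset.sum_congr rfl fun i _ => hall i
    rw [Finset.sum_sub_distrib] at h1
    have h2 : ∑ i, z.1 (i + 1) = ∑ i, z.1 i := Equiv.sum_comp (Equiv.addRight (1 : Fin n)) z.1
    rw [h2, sub_self, Finset.sum_const, Finset.card_univ, Fintype.card_fin, nsmul_eq_mul] at h1
    exact (mul_eq_zero.1 h1.symm).resolve_left hn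
  have heq : ∀ m : ℕ, z.1 (Fin.ofNat n m) = z.1 0 := by
    intro m
    induction m with
    | zero =>
      have : Fin.ofNat n 0 = 0 := by apply Fin.ext; simp [Fin.ofNat]
      rw [this]
    | succ m ih =>
      have : Fin.ofNat n (m + 1) = Fin.ofNat n m + 1 := by
        apply Fin.ext
        simp [Fin.ofNat, Fin.val_add]
      have h3 := hall (Fin.ofNat n m)
      rw [this]
      linarith
  have hq : ∀ i : Fin n, z.1 i = z.1 0 := by
    intro i
    have h2 : Fin.ofNat n i.val = i := by
      apply Fin.ext
      simp [Fin.ofNat, Nat.mod_eq_of_lt i.2]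
    rw [← h2]
    exact heq _
  have hq0 : z.1 0 = 0 := by
    rw [Finset.sum_congr rfl fun i _ => hq i, Finset.sum_const, Finset.card_univ, Fintype.card_fin,
      nsmul_eq_mul] at hQ
    exact (mul_eq_zero.1 hQ).resolve_left hn
  refine Prod.ext (funext fun i => ?_) hp
  rw [hq, hq0]
  rfl

/-- All gaps are closed at the equilibrium. -/
lemma gap_zero {n : ℕ} [NeZero n] (j : Fin (n - 1)) : gap j (0 : Phase n) = 0 := by
  -- At the origin M is a power of a single transfer matrix and commutes with it; together with M₀₁
  -- = 0 this forces M to be scalar.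
  have hc : ∀ (x : ℝ) (k : ℕ), mono (0 : Phase n) x k * transfer (0 : Phase n) x 0 =
      transfer (0 : Phase n) x 0 * mono (0 : Phase n) x k := by
    intro x k
    induction k with
    | zero => simp [mono]
    | succ k ih =>
      have h1 : transfer (0 : Phase n) x (Fin.ofNat n k) = transfer (0 : Phase n) x 0 := by
        simp [transfer]
      rw [mono, h1, Matrix.mul_assoc, ih]
  set x := dirichlet j (0 : Phase n) with hx
  have hM : mono (0 : Phase n) x n 0 1 = 0 := mono_dirichlet j 0
  have h1 := congrFun (congrFun (hc x n) 0) 0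
  have h2 := congrFun (congrFun (hc x n) 1) 0
  simp [Matrix.mul_apply, transfer, hM] at h1 h2
  ext e
  fin_cases e
  · have h3 : mono (0 : Phase n) x n 1 0 = 0 := by
      linarith [mul_comm (mono (0 : Phase n) x n 0 0) x]
    rw [h3] at h2
    simp [gap, ← hx]
    linarith
  · simp [gap, ← hx]
    linarith

/-! ### Connectedness -/

/-- The set where at least the gaps in `S` are closed. -/
def closedStratum {n : ℕ} [NeZero n] (S : Finset (Fin (n - 1))) : Set (Phase n) :=
  {z | S ⊆ closedGaps z}

lemma closedStratum_eq {n : ℕ} [NeZero n] (S : Finset (Fin (n - 1))) :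
    closedStratum (n := n) S = {z | gapMap S z = 0} := by
  ext z
  constructor
  · intro h
    exact funext fun j => mem_closedGaps.1 (h j.2)
  · intro h j hj
    exact mem_closedGaps.2 (congrFun h ⟨j, hj⟩)

lemma isClosed_closedStratum {n : ℕ} [NeZero n] (S : Finset (Fin (n - 1))) :
    IsClosed (closedStratum (n := n) S) := by
  rw [closedStratum_eq]
  exact isClosed_eq (contDiff_gapMap S).continuous continuous_const

/-- By Lagrange multipliers dE vanishes on the tangent space. Testing on the tangent vector `qshift`
gives Σ q_i = 0; then the Toda field is tangent and orthogonal to the symplectic tangent space, so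
it is zero. -/
lemma eq_zero_of_isLocalMinOn {n : ℕ} [NeZero n] {S : Finset (Fin (n - 1))} {z : Phase n}
    (hz : z ∈ closedStratum S) (h : IsLocalMinOn energy (closedStratum S) z) : z = 0 := by
  have hz0 : gapMap S z = 0 := by rwa [closedStratum_eq] at hz
  have hS : ∀ j ∈ S, gap j z = 0 := fun j hj => mem_closedGaps.1 (hz hj)
  have hext : IsLocalExtrOn energy {y | gapMap S y = gapMap S z} z := by
    rw [hz0, ← closedStratum_eq]
    exact Or.inl h
  obtain ⟨Λ, Λ₀, hne, hΛ⟩ := hext.exists_linear_map_of_hasStrictFDerivAt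
    ((contDiff_gapMap S).contDiffAt.hasStrictFDerivAt (by simp))
    (contDiff_energy.contDiffAt.hasStrictFDerivAt (by simp))
  have hΛ₀ : Λ₀ ≠ 0 := by
    rintro rfl
    apply hne
    rw [Prod.mk_eq_zero]
    refine ⟨LinearMap.ext fun y => ?_, rfl⟩
    obtain ⟨v, rfl⟩ := surjective_fderiv_gapMap hz y
    simpa using hΛ v
  have hcrit : ∀ w, (∀ j ∈ S, fderiv ℝ (gap j) z w = 0) → fderiv ℝ energy z w = 0 := by
    intro w hw
    have h1 : fderiv ℝ (gapMap S) z w = 0 := by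
      ext1 j
      rw [fderiv_gapMap, hw j j.2]
      rfl
    have h2 := hΛ w
    rw [h1, map_zero, zero_add, smul_eq_mul] at h2
    exact (mul_eq_zero.1 h2).resolve_left hΛ₀
  have hn : (n : ℝ) ≠ 0 := Nat.cast_ne_zero.2 (NeZero.ne n)
  have hQ : ∑ i, z.1 i = 0 := by
    have h1 := hcrit (qshift n) fun j hj =>
      fderiv_gap_eq_zero_of_commutator (hS j hj) (dmono_qshift z _ n)
    rw [fderiv_energy] at h1
    have h2 := sum_shift z fun _ => 1
    have h3 : omega (todaField z) (qshift n) = 0 := by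
      simp only [mul_one] at h2
      simp [omega, todaField, qshift, h2]
    rw [h3] at h1
    simpa [qshift, hn] using h1
  refine eq_zero_of_todaField ?_ hQ
  refine ker_gap_symplectic hS (fun j hj => ?_) fun w hw => ?_
  · obtain ⟨A, hA⟩ := dmono_todaField z (dirichlet j z)
    exact fderiv_gap_eq_zero_of_commutator (hS j hj) hA
  · have h1 := hcrit w hw
    rw [fderiv_energy, hQ] at h1
    simpa using h1

/-- On each of two disjoint closed pieces the proper energy attains a minimum, which is a local
minimum on the whole set and hence the origin; but the origin cannot lie in both. -/
lemma isPreconnected_closedStratum {n : ℕ} [NeZero n] (S : Finset (Fin (n - 1))) :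
    IsPreconnected (closedStratum (n := n) S) := by
  rw [isPreconnected_closed_iff]
  have key : ∀ t t' : Set (Phase n), IsClosed t → IsClosed t' → closedStratum S ⊆ t ∪ t' →
      (closedStratum S ∩ t).Nonempty → ¬ (closedStratum S ∩ (t ∩ t')).Nonempty → 0 ∈ t := by
    rintro t t' ht ht' hsub ⟨a, ha⟩ hemp
    have hcomp : IsCompact ((closedStratum S ∩ t) ∩ {z | energy z ≤ energy a}) :=
      (isCompact_energy_le _).inter_left ((isClosed_closedStratum S).inter ht)
    obtain ⟨m, hm, hmin⟩ := hcomp.exists_isMinOn ⟨a, ha, le_refl (energy a)⟩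
      contDiff_energy.continuous.continuousOn
    have hmt' : m ∉ t' := fun h => hemp ⟨m, hm.1.1, hm.1.2, h⟩
    have hloc : IsLocalMinOn energy (closedStratum S) m := by
      filter_upwards [self_mem_nhdsWithin,
        mem_nhdsWithin_of_mem_nhds (ht'.isOpen_compl.mem_nhds hmt')] with y hy hyt'
      have hyt : y ∈ t := (hsub hy).resolve_right hyt'
      by_cases hle : energy y ≤ energy a
      · exact hmin ⟨⟨hy, hyt⟩, hle⟩
      · have hma : energy m ≤ energy a := hm.2
        linarith
    rw [← eq_zero_of_isLocalMinOn hm.1.1 hloc]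
    exact hm.1.2
  intro t t' ht ht' hsub h1 h2
  by_contra hemp
  have m1 := key t t' ht ht' hsub h1 hemp
  have m2 := key t' t ht' ht (by rwa [Set.union_comm]) h2 (by rwa [Set.inter_comm t' t])
  exact hemp ⟨0, fun j _ => mem_closedGaps.2 (gap_zero j), m1, m2⟩

/-! ### From closed strata to strata -/

lemma closedStratum_subset_closure {n : ℕ} [NeZero n] (S : Finset (Fin (n - 1))) :
    closedStratum (n := n) S ⊆ closure (stratum S) := by
  intro z hz
  rw [mem_closure_iff_nhds]
  intro O hO
  obtain ⟨V, -, hVO, -, y, hy⟩ := exists_isPreconnected_inter_stratum hz hO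
  exact ⟨y, hVO hy.1, hy.2⟩

lemma stratum_subset_closedStratum {n : ℕ} [NeZero n] (S : Finset (Fin (n - 1))) :
    stratum (n := n) S ⊆ closedStratum S := fun z hz => by
  have : closedGaps z = S := hz
  exact this.symm.subset

lemma closure_stratum {n : ℕ} [NeZero n] (S : Finset (Fin (n - 1))) :
    closure (stratum (n := n) S) = closedStratum S :=
  subset_antisymm ((isClosed_closedStratum S).closure_subset_iff.2 (stratum_subset_closedStratum S))
    (closedStratum_subset_closure S)

lemma stratum_nonempty {n : ℕ} [NeZero n] (S : Finset (Fin (n - 1))) :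
    (stratum (n := n) S).Nonempty := by
  rw [← closure_nonempty_iff, closure_stratum]
  exact ⟨0, fun j _ => mem_closedGaps.2 (gap_zero j)⟩

/-- If u and v split the stratum, the closures of the two parts cover the connected closed stratum
and meet at some z. Near z the stratum has a connected trace, which meets both u and v. -/
lemma isPreconnected_stratum {n : ℕ} [NeZero n] (S : Finset (Fin (n - 1))) :
    IsPreconnected (stratum (n := n) S) := by
  intro u v hu hv huv h1 h2
  have hcover : closedStratum (n := n) S ⊆
      closure (stratum S ∩ u) ∪ closure (stratum S ∩ v) := by
    rw [← closure_stratum, ← closure_union, ← Set.inter_union_distrib_left]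
    exact closure_mono (Set.subset_inter subset_rfl huv)
  have hne : ∀ t : Set (Phase n), (stratum S ∩ t).Nonempty →
      (closedStratum S ∩ closure (stratum S ∩ t)).Nonempty := by
    rintro t ⟨y, hy⟩
    exact ⟨y, stratum_subset_closedStratum S hy.1, subset_closure hy⟩
  obtain ⟨z, hzS, hzu, hzv⟩ := isPreconnected_closed_iff.1 (isPreconnected_closedStratum (n := n) S)
    _ _ isClosed_closure isClosed_closure hcover (hne u h1) (hne v h2)
  obtain ⟨V, hV, -, hVpre, -⟩ := exists_isPreconnected_inter_stratum hzS Filter.univ_mem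
  obtain ⟨a, haV, haS, hau⟩ := mem_closure_iff_nhds.1 hzu V hV
  obtain ⟨c, hcV, hcS, hcv⟩ := mem_closure_iff_nhds.1 hzv V hV
  obtain ⟨y, hy, hyuv⟩ := hVpre u v hu hv (Set.inter_subset_right.trans huv)
    ⟨a, ⟨haV, haS⟩, hau⟩ ⟨c, ⟨hcV, hcS⟩, hcv⟩
  exact ⟨y, hy.2, hyuv⟩

/-! ### The components of the singular sets -/

lemma stratum_subset_singularSet {n : ℕ} [NeZero n] (S : Finset (Fin (n - 1))) :
    stratum (n := n) S ⊆ singularSet n S.card := by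
  intro z hz
  have : closedGaps z = S := hz
  rw [singularSet_eq]
  exact congrArg Finset.card this

lemma disjoint_closedStratum {n : ℕ} [NeZero n] {S T : Finset (Fin (n - 1))}
    (hcard : S.card = T.card) (hST : S ≠ T) :
    Disjoint (stratum (n := n) S) (closedStratum T) := by
  rw [Set.disjoint_left]
  intro z hz hzT
  have h1 : closedGaps z = S := hz
  have h2 : T ⊆ closedGaps z := hzT
  rw [h1] at h2
  exact hST (Finset.eq_of_subset_of_card_le h2 hcard.le).symm

/-- Among points with exactly k closed gaps, the finitely many closed strata with |T| = k are
pairwise disjoint, so a connected subset stays in one of them. -/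
lemma connectedComponentIn_singularSet {n : ℕ} [NeZero n] {k : ℕ} {z : Phase n}
    (hz : z ∈ singularSet n k) :
    connectedComponentIn (singularSet n k) z = stratum (closedGaps z) := by
  have hk : (closedGaps z).card = k := by rwa [singularSet_eq] at hz
  apply subset_antisymm
  · intro y hy
    set C := connectedComponentIn (singularSet n k) z with hC
    have hsub : C ⊆ singularSet n k := connectedComponentIn_subset _ _
    have hyk : (closedGaps y).card = k := by
      have := hsub hy
      rwa [singularSet_eq] at this
    by_contra hne
    set R : Set (Phase n) := ⋃ T ∈ (Finset.univ.filter fun T : Finset (Fin (n - 1)) =>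
      T.card = k ∧ T ≠ closedGaps z), closedStratum T with hR
    have hRc : IsClosed R :=
      (Finset.finite_toSet _).isClosed_biUnion fun T _ => isClosed_closedStratum T
    have hcover : C ⊆ closedStratum (closedGaps z) ∪ R := by
      intro w hw
      have hwk : (closedGaps w).card = k := by
        have := hsub hw
        rwa [singularSet_eq] at this
      by_cases h : closedGaps w = closedGaps z
      · exact Or.inl h.symm.subset
      · refine Or.inr (Set.mem_biUnion (x := closedGaps w) ?_ (Finset.Subset.refl _))
        simp [hwk, h]
    obtain ⟨w, hwC, hw1, hw2⟩ := isPreconnected_closed_iff.1 isPreconnected_connectedComponentIn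
      _ _ (isClosed_closedStratum _) hRc hcover
      ⟨z, mem_connectedComponentIn hz, Finset.Subset.refl _⟩
      ⟨y, hy, Set.mem_biUnion (x := closedGaps y) (by
        have hne' : closedGaps y ≠ closedGaps z := hne
        simpa [hyk] using hne')
        (Finset.Subset.refl _)⟩
    have hwk : (closedGaps w).card = k := by
      have := hsub hwC
      rwa [singularSet_eq] at this
    obtain ⟨T, hT, hwT⟩ := Set.mem_iUnion₂.1 hw2
    obtain ⟨hTk, hTne⟩ := (Finset.mem_filter.1 hT).2
    have e1 := Finset.eq_of_subset_of_card_le hw1 (by rw [hwk, hk])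
    have e2 := Finset.eq_of_subset_of_card_le hwT (by rw [hwk, hTk])
    exact hTne (e2.trans e1.symm)
  · have hst : stratum (closedGaps z) ⊆ singularSet n k := hk ▸ stratum_subset_singularSet _
    exact (isPreconnected_stratum _).subset_connectedComponentIn (x := z) rfl hst

lemma components_singularSet {n : ℕ} [NeZero n] (k : ℕ) :
    components (singularSet n k) =
      stratum '' (Finset.powersetCard k (Finset.univ : Finset (Fin (n - 1))) : Set _) := by
  ext C
  constructor
  · rintro ⟨z, hz, rfl⟩
    rw [connectedComponentIn_singularSet hz]
    refine ⟨closedGaps z, ?_, rfl⟩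
    rw [singularSet_eq] at hz
    simpa using hz
  · rintro ⟨S, hS, rfl⟩
    have hS' : S.card = k := by simpa using hS
    obtain ⟨z, hz⟩ := stratum_nonempty S
    have hzk : z ∈ singularSet n k := hS' ▸ stratum_subset_singularSet S hz
    refine ⟨z, hzk, ?_⟩
    rw [connectedComponentIn_singularSet hzk]
    congr 1

lemma stratum_injective {n : ℕ} [NeZero n] : Function.Injective (stratum (n := n)) := by
  intro S T h
  obtain ⟨z, hz⟩ := stratum_nonempty S
  have h1 : closedGaps z = S := hz
  have h2 : z ∈ stratum T := h ▸ hz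
  exact h1.symm.trans h2

end Toda

end

theorem theorem2 (n : ℕ) [NeZero n] (k : ℕ) :
    Toda.IsSymplecticSubmanifold (Toda.singularSet n k) (2 * k) ∧
    (Toda.components (Toda.singularSet n k)).encard = ((n - 1).choose k : ℕ∞) ∧
    (∀ C ∈ Toda.components (Toda.singularSet n k),
      ∀ D ∈ Toda.components (Toda.singularSet n k),
        C ≠ D → Disjoint C (closure D)) ∧
    (∀ j < k, Toda.singularSet n k ⊆ closure (Toda.singularSet n j)) := by
  refine ⟨Toda.isSymplecticSubmanifold_singularSet k, ?_, ?_, ?_⟩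
  · rw [Toda.components_singularSet, Toda.stratum_injective.encard_image, Set.encard_coe_eq_coe_finsetCard,
      Finset.card_powersetCard, Finset.card_univ, Fintype.card_fin]
  · intro C hC D hD hCD
    rw [Toda.components_singularSet] at hC hD
    obtain ⟨S, hS, rfl⟩ := hC
    obtain ⟨T, hT, rfl⟩ := hD
    rw [Toda.closure_stratum]
    have hS' : S.card = k := by simpa using hS
    have hT' : T.card = k := by simpa using hT
    exact Toda.disjoint_closedStratum (hS'.trans hT'.symm) fun h => hCD (h ▸ rfl)
  · intro j hj z hz
    have hk : (Toda.closedGaps z).card = k := by rwa [Toda.singularSet_eq] at hz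
    -- Any j of the k closed gaps can be kept closed while the others are opened by an arbitrarily
    -- small perturbation.
    obtain ⟨S, hS, hSj⟩ := Finset.exists_subset_card_eq (hj.le.trans hk.ge)
    have h1 := Toda.closedStratum_subset_closure S hS
    exact closure_mono (hSj ▸ Toda.stratum_subset_singularSet S) h1
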